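/- **Corollary (multiplicative PTAS for discrete unit-demand pricing).** In the unit-demand pricing problem a seller offers $n$ items to one buyer. The buyer's value $v_i\ge 0$ for item $i$ is drawn from a distribution $F_i$, independently over the items. Each $F_i$ has finite support and is given explicitly, as a list of mass points (nonnegative rational values) with positive rational probabilities that sum to $1$, all numerators and denominators being written in binary. The seller posts a price $p_i\ge 0$ for every item, without any restriction on the prices. The buyer buys an item $i^*$ that maximizes $v_i-p_i$ and pays $p_{i^*}$, provided that $v_{i^*}-p_{i^*}\ge 0$, and otherwise buys nothing and pays $0$; ties are broken in favour of the seller. Let $\mathcal R_I(p)$ be the expected payment at the prices $p$ in the instance $I$. There is a multiplicative PTAS for this problem, that is, there is an algorithm $A$ with the following property. For every rational $\varepsilon\in(0,1)$ there is a polynomial $q_\varepsilon$ such that for every instance $I$ (with any number $n$ of items), $A$ on input $(\varepsilon,I)$ halts in time at most $q_\varepsilon(|I|)$, where $|I|$ is the bit size of $I$, and outputs a vector $\hat p$ of nonnegative rational prices with $$\mathcal R_I(\hat p)\;\ge\;(1-\varepsilon)\,\mathcal R_I(p)\qquad\text{for all } p\in[0,\infty)^n .$$ Time is measured on a machine whose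 elementary operations (copying and forming pairs, projections, and addition, truncated subtraction, multiplication and integer division of natural numbers) each cost the bit size of the data that they read and write (logarithmic cost). -/

import Mathlib

open scoped BigOperators

/-! ### A model of computation with logarithmic (bit) cost

Programs manipulate finite binary trees whose leaves are natural numbers.  Every operation is charged
the total bit size of the data that it reads and writes, as in the logarithmic-cost random access
machine, so that running times are polynomially related to those of Turing machines.  The language
has an unbounded loop and is Turing complete. -/

namespace BitCost

/-- The data of the model: binary trees with natural numbers at the leaves. -/
inductive Val : Type
  | nat (n : ℕ) : Val
  | pair (a b : Val) : Val

namespace Val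

/-- The bit size of a datum: a leaf `n` counts its binary digits plus one, an inner node counts
one. -/
def size : Val → ℕ
  | nat n => Nat.size n + 1
  | pair a b => a.size + b.size + 1

/-- Lists as data: the empty list is the leaf `0`. -/
def list : List Val → Val
  | [] => nat 0
  | a :: l => pair a (list l)

/-- The fraction `a / b` as a datum. -/
def frac (a b : ℕ) : Val := pair (nat a) (nat b)

/-- A nonnegative rational number as a datum: numerator and denominator in lowest terms. -/
def rat (x : NNRat) : Val := frac x.num x.den

end Val

/-- The elementary operations. -/
inductive Op : Type
  | id
  | const (n : ℕ)
  | fst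
  | snd
  | add
  | sub
  | mul
  | div

/-- The result of an elementary operation; `none` means that the operation is not applicable.
Subtraction is truncated at `0` and `div` is the integer quotient, with `n / 0 = 0`. -/
def Op.apply : Op → Val → Option Val
  | .id, x => some x
  | .const n, _ => some (.nat n)
  | .fst, .pair a _ => some a
  | .snd, .pair _ b => some b
  | .add, .pair (.nat a) (.nat b) => some (.nat (a + b))
  | .sub, .pair (.nat a) (.nat b) => some (.nat (a - b))
  | .mul, .pair (.nat a) (.nat b) => some (.nat (a * b))
  | .div, .pair (.nat a) (.nat b) => some (.nat (a / b))
  | _, _ => none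

/-- Programs: elementary operations, sequential composition `seq f g` (first `f`, then `g`), pairing
`both f g` (run `f` and `g` on copies of the input and pair the results), branching and loops. -/
inductive Prog : Type
  | op (o : Op)
  | seq (f g : Prog)
  | both (f g : Prog)
  | ite (c f g : Prog)
  | loop (c f : Prog)

/-- `Runs P x y t`: the program `P` started on `x` halts with the result `y` after time `t`.  A
condition counts as false exactly when it evaluates to the leaf `0`; `loop c f` repeats `f` as long
as `c` is true.  Elementary operations cost the size of their input plus the size of their output,
so that in every run the time is at least the size of the input and of the output. -/
inductive Runs : Prog → Val → Val → ℕ → Prop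
  | op {o : Op} {x y : Val} (h : o.apply x = some y) :
      Runs (.op o) x y (x.size + y.size)
  | seq {f g : Prog} {x y z : Val} {s t : ℕ} (hf : Runs f x y s) (hg : Runs g y z t) :
      Runs (.seq f g) x z (s + t + 1)
  | both {f g : Prog} {x y z : Val} {s t : ℕ} (hf : Runs f x y s) (hg : Runs g x z t) :
      Runs (.both f g) x (.pair y z) (s + t + 1)
  | ite_true {c f g : Prog} {x b y : Val} {s t : ℕ} (hc : Runs c x b s) (hb : b ≠ .nat 0)
      (hf : Runs f x y t) : Runs (.ite c f g) x y (s + t + 1)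
  | ite_false {c f g : Prog} {x y : Val} {s t : ℕ} (hc : Runs c x (.nat 0) s)
      (hg : Runs g x y t) : Runs (.ite c f g) x y (s + t + 1)
  | loop_done {c f : Prog} {x : Val} {s : ℕ} (hc : Runs c x (.nat 0) s) :
      Runs (.loop c f) x x (s + 1)
  | loop_step {c f : Prog} {x b y z : Val} {r s t : ℕ} (hc : Runs c x b r) (hb : b ≠ .nat 0)
      (hf : Runs f x y s) (hl : Runs (.loop c f) y z t) :
      Runs (.loop c f) x z (r + s + t + 1)

/-- Programs are deterministic: the result and the running time are functions of the input. -/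
theorem Runs.deterministic {P : Prog} {x y y' : Val} {t t' : ℕ} (h : Runs P x y t)
    (h' : Runs P x y' t') : y = y' ∧ t = t' := by
  induction h generalizing y' t' with
  | op h =>
    cases h' with
    | op h2 =>
      rw [h] at h2
      cases h2
      exact ⟨rfl, rfl⟩
  | seq _ _ ih1 ih2 =>
    cases h' with
    | seq a b =>
      obtain ⟨rfl, rfl⟩ := ih1 a
      obtain ⟨rfl, rfl⟩ := ih2 b
      exact ⟨rfl, rfl⟩
  | both _ _ ih1 ih2 =>
    cases h' with
    | both a b =>
      obtain ⟨rfl, rfl⟩ := ih1 a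
      obtain ⟨rfl, rfl⟩ := ih2 b
      exact ⟨rfl, rfl⟩
  | ite_true _ hb _ ih1 ih2 =>
    cases h' with
    | ite_true a _ b =>
      obtain ⟨rfl, rfl⟩ := ih1 a
      obtain ⟨rfl, rfl⟩ := ih2 b
      exact ⟨rfl, rfl⟩
    | ite_false a _ => exact absurd (ih1 a).1 hb
  | ite_false _ _ ih1 ih2 =>
    cases h' with
    | ite_true a hb _ => exact absurd (ih1 a).1.symm hb
    | ite_false a b =>
      obtain ⟨_, rfl⟩ := ih1 a
      obtain ⟨rfl, rfl⟩ := ih2 b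
      exact ⟨rfl, rfl⟩
  | loop_done _ ih =>
    cases h' with
    | loop_done a =>
      obtain ⟨_, rfl⟩ := ih a
      exact ⟨rfl, rfl⟩
    | loop_step a hb _ _ => exact absurd (ih a).1.symm hb
  | loop_step _ hb _ _ ih1 ih2 ih3 =>
    cases h' with
    | loop_done a => exact absurd (ih1 a).1 hb
    | loop_step a _ b c =>
      obtain ⟨rfl, rfl⟩ := ih1 a
      obtain ⟨rfl, rfl⟩ := ih2 b
      obtain ⟨rfl, rfl⟩ := ih3 c
      exact ⟨rfl, rfl⟩

end BitCost

/-! ### Unit-demand pricing with independent, finitely supported values -/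

namespace UnitDemand

/-- An instance: `n` items, where the value of item `i` equals `value i k` with probability
`prob i k`, for `k` ranging over the `K i` mass points of item `i`. -/
structure Instance where
  n : ℕ
  K : Fin n → ℕ
  value : (i : Fin n) → Fin (K i) → NNRat
  prob : (i : Fin n) → Fin (K i) → NNRat
  prob_pos : ∀ i k, 0 < prob i k
  prob_sum : ∀ i, ∑ k, prob i k = 1

open Classical in
/-- The items among which a buyer with values `v` chooses at prices `p`: those that maximize the
utility `v i - p i`, provided that this utility is nonnegative. -/
noncomputable def favourites {n : ℕ} (v p : Fin n → ℝ) : Finset (Fin n) :=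
  Finset.univ.filter fun i => 0 ≤ v i - p i ∧ ∀ j, v j - p j ≤ v i - p i

open Classical in
/-- The seller's revenue from a buyer with values `v` at prices `p`: the price of the favourite item,
ties being broken in favour of the seller, and `0` if every item has negative utility. -/
noncomputable def payment {n : ℕ} (v p : Fin n → ℝ) : ℝ :=
  if h : (favourites v p).Nonempty then (favourites v p).sup' h p else 0

namespace Instance

/-- The expected revenue of the prices `p`.  The values of the items are independent, so a profile
`s` of mass points, one for each item, has probability `∏ i, prob i (s i)`. -/
noncomputable def revenue (I : Instance) (p : Fin I.n → ℝ) : ℝ :=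
  ∑ s : (i : Fin I.n) → Fin (I.K i),
    (∏ i, (I.prob i (s i) : ℝ)) * payment (fun i => (I.value i (s i) : ℝ)) p

/-- The instance as an input: the list, over the items, of the lists of the mass points, each given
by its value and its probability, with numerators and denominators in binary. -/
def encode (I : Instance) : BitCost.Val :=
  .list (List.ofFn fun i => .list (List.ofFn fun k =>
    .pair (.rat (I.value i k)) (.rat (I.prob i k))))

end Instance

/-- The output that lists the prices `a i / b i` of the items. -/
def encodePrices {n : ℕ} (a b : Fin n → ℕ) : BitCost.Val :=
  .list (List.ofFn fun i => .frac (a i) (b i))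

end UnitDemand

/-!
Let `E` be the least value, over `H` equal to zero or a mass point, of `H` plus the sum over the
items of the best revenue from selling the item alone at a price above `H`.  It lies between the
optimum and four times the optimum, and for `y > E` the probabilities that the single values are at
least `y` sum to at most `E / y`.  Values far above `E` are therefore so rare that an item with a
very high price contributes its single-item revenue, as if the other items were not there.

All other prices are rounded to multiples of `E / r ^ 2`, where `r` is of order `1 / ε`.  Reducing
all prices by the factor `1 - 1 / r` pushes the buyer towards the more expensive items, which makes
up for the rounding of the values and the prices.  The revenue from these items then depends only on
the item of largest rank, where items are ranked by rounded utility and then by price, and by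
independence the distribution function of the largest rank is the product of those of the items.
For fixed `r` the number of ranks is fixed, so a dynamic program over these products, rounded down
to multiples of a polynomially small unit, has polynomially many states and finds nearly the best
combination of prices.
-/

namespace BitCost

theorem Val.size_pos : ∀ x : Val, 0 < x.size
  | .nat _ => Nat.succ_pos _
  | .pair _ _ => Nat.succ_pos _

theorem Runs.size_le {P : Prog} {x y : Val} {t : ℕ} (h : Runs P x y t) :
    x.size ≤ t ∧ y.size ≤ t := by
  induction h <;> (try simp only [Val.size]) <;> omega

theorem size_add_le (a b : ℕ) : Nat.size (a + b) ≤ max (Nat.size a) (Nat.size b) + 1 := by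
  rw [Nat.size_le, pow_succ, mul_two]
  exact add_lt_add ((Nat.lt_size_self a).trans_le (Nat.pow_le_pow_right two_pos (le_max_left _ _)))
    ((Nat.lt_size_self b).trans_le (Nat.pow_le_pow_right two_pos (le_max_right _ _)))

theorem size_mul_le (a b : ℕ) : Nat.size (a * b) ≤ Nat.size a + Nat.size b := by
  rw [Nat.size_le, pow_add]
  exact Nat.mul_lt_mul'' (Nat.lt_size_self a) (Nat.lt_size_self b)

theorem monotone_polynomial_eval (q : Polynomial ℕ) : Monotone fun n => q.eval n := by
  intro a b hab
  simp only [Polynomial.eval_eq_sum]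
  exact Finset.sum_le_sum fun i _ => Nat.mul_le_mul le_rfl (Nat.pow_le_pow_left hab i)

/-- One iteration of the loop that computes a fold: the first entry of the list is removed and
applied to the accumulator. -/
def foldlStep {α γ σ : Type} (step : γ → σ → α → σ) (p : γ × List α × σ) : γ × List α × σ :=
  p.2.1.next?.elim p fun al => (p.1, al.2, step p.1 p.2.2 al.1)

theorem iterate_foldlStep {α γ σ : Type} (step : γ → σ → α → σ) (c : γ) (s : σ) {l : List α}
    {i : ℕ} (hi : i ≤ l.length) :
    (foldlStep step)^[i] (c, l, s) = (c, l.drop i, (l.take i).foldl (step c) s) := by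
  induction i generalizing l s with
  | zero => simp
  | succ i ih =>
    cases l with
    | nil => simp at hi
    | cons a l => simpa [foldlStep] using ih (step c s a) (by simpa using hi)

/-- Types whose elements are represented by data of the machine. -/
class Enc (α : Type) where
  /-- The representation of an element. -/
  enc : α → Val

open Enc

instance : Enc ℕ := ⟨.nat⟩

instance {α β : Type} [Enc α] [Enc β] : Enc (α × β) := ⟨fun p => .pair (enc p.1) (enc p.2)⟩

instance {α : Type} [Enc α] : Enc (List α) := ⟨fun l => .list (l.map enc)⟩

instance {α : Type} [Enc α] : Enc (Option α) := ⟨fun o => enc o.toList⟩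

/-- The bit size of the representation of an element. -/
def bitSize {α : Type} [Enc α] (a : α) : ℕ := (enc a).size

variable {α β γ δ σ : Type} [Enc α] [Enc β] [Enc γ] [Enc δ] [Enc σ]

@[simp] theorem enc_pair (a : α) (b : β) : enc (a, b) = .pair (enc a) (enc b) := rfl

@[simp] theorem enc_nat (n : ℕ) : enc n = .nat n := rfl

@[simp] theorem enc_nil : enc ([] : List α) = .nat 0 := rfl

@[simp] theorem enc_cons (a : α) (l : List α) : enc (a :: l) = .pair (enc a) (enc l) := rfl

@[simp] theorem enc_none : enc (none : Option α) = .nat 0 := rfl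

@[simp] theorem enc_some (a : α) : enc (some a) = .pair (enc a) (.nat 0) := rfl

theorem bitSize_prod (p : α × β) : bitSize p = bitSize p.1 + bitSize p.2 + 1 := rfl

@[simp] theorem bitSize_pair (a : α) (b : β) : bitSize (a, b) = bitSize a + bitSize b + 1 := rfl

theorem bitSize_nat (n : ℕ) : bitSize n = Nat.size n + 1 := rfl

@[simp] theorem bitSize_nil : bitSize ([] : List α) = 1 := by simp [bitSize, Val.size]

@[simp] theorem bitSize_cons (a : α) (l : List α) :
    bitSize (a :: l) = bitSize a + bitSize l + 1 := rfl

@[simp] theorem bitSize_none : bitSize (none : Option α) = 1 := bitSize_nil (α := α)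

@[simp] theorem bitSize_some (a : α) : bitSize (some a) = bitSize a + 2 := by
  simp [bitSize, Val.size]

theorem bitSize_le_succ (n : ℕ) : bitSize n ≤ n + 1 :=
  Nat.succ_le_succ (Nat.size_le.2 Nat.lt_two_pow_self)

theorem bitSize_mono {a b : ℕ} (h : a ≤ b) : bitSize a ≤ bitSize b :=
  Nat.succ_le_succ (Nat.size_le_size h)

theorem bitSize_add_le (a b : ℕ) : bitSize (a + b) ≤ bitSize a + bitSize b := by
  have := size_add_le a b
  simp only [bitSize_nat]
  omega

theorem bitSize_mul_le (a b : ℕ) : bitSize (a * b) ≤ bitSize a + bitSize b := by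
  have := size_mul_le a b
  simp only [bitSize_nat]
  omega

theorem bitSize_append (l m : List α) : bitSize (l ++ m) + 1 = bitSize l + bitSize m := by
  induction l with
  | nil => simp [add_comm]
  | cons a l ih => simp only [List.cons_append, bitSize_cons]; omega

theorem bitSize_le_of_suffix {l m : List α} (h : l <:+ m) : bitSize l ≤ bitSize m := by
  obtain ⟨k, rfl⟩ := h
  have := bitSize_append k l
  have : 0 < bitSize k := Val.size_pos _
  omega

theorem bitSize_le_of_mem {a : α} {l : List α} (h : a ∈ l) : bitSize a ≤ bitSize l := by
  induction h with
  | head => simp only [bitSize_cons]; omega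
  | tail _ _ ih => simp only [bitSize_cons]; omega

theorem length_lt_bitSize (l : List α) : l.length < bitSize l := by
  induction l with
  | nil => simp
  | cons a l ih => simp only [bitSize_cons, List.length_cons]; omega

theorem bitSize_list_le {l : List α} {B : ℕ} (h : ∀ a ∈ l, bitSize a ≤ B) :
    bitSize l ≤ l.length * (B + 1) + 1 := by
  induction l with
  | nil => simp
  | cons a l ih =>
    have tail_le := ih fun a ha => h a (List.mem_cons_of_mem _ ha)
    have head_le := h a List.mem_cons_self
    simp only [bitSize_cons, List.length_cons, Nat.add_mul]
    omega

theorem bitSize_foldl_le {ι : Type} {step : σ → ι → σ} {b : ℕ} {l : List ι}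
    (h : ∀ s, ∀ a ∈ l, bitSize (step s a) ≤ bitSize s + b) (s : σ) :
    bitSize (l.foldl step s) ≤ bitSize s + l.length * b := by
  induction l generalizing s with
  | nil => simp
  | cons a l ih =>
    have tail_le := ih (fun s a ha => h s a (List.mem_cons_of_mem _ ha)) (step s a)
    have head_le := h s a List.mem_cons_self
    simp only [List.foldl_cons, List.length_cons, Nat.add_mul, one_mul]
    omega

/-- `f` is computed by a program whose running time is polynomial in the measure `κ` of the
input. -/
def TimeIn (κ : α → ℕ) (f : α → β) : Prop :=
  ∃ (P : Prog) (q : Polynomial ℕ), ∀ a, ∃ t, Runs P (enc a) (enc (f a)) t ∧ t ≤ q.eval (κ a)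

/-- `f` is computable in polynomial time. -/
@[fun_prop]
def PolyTime (f : α → β) : Prop := TimeIn bitSize f

namespace TimeIn

variable {κ : α → ℕ} {f : α → β}

theorem bitSize_le (h : TimeIn κ f) : ∃ q : Polynomial ℕ, ∀ a, bitSize (f a) ≤ q.eval (κ a) := by
  obtain ⟨P, q, hP⟩ := h
  refine ⟨q, fun a => ?_⟩
  obtain ⟨t, run, ht⟩ := hP a
  exact run.size_le.2.trans ht

theorem comp {g : β → γ} (hg : PolyTime g) (hf : TimeIn κ f) : TimeIn κ fun a => g (f a) := by
  obtain ⟨P, p, hP⟩ := hf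
  obtain ⟨Q, q, hQ⟩ := hg
  refine ⟨.seq P Q, p + q.comp p + 1, fun a => ?_⟩
  obtain ⟨s, runP, hs⟩ := hP a
  obtain ⟨t, runQ, ht⟩ := hQ (f a)
  refine ⟨_, .seq runP runQ, ?_⟩
  have ht' := ht.trans (monotone_polynomial_eval q (runP.size_le.2.trans hs))
  simp only [Polynomial.eval_add, Polynomial.eval_comp, Polynomial.eval_one] at ht' ⊢
  omega

theorem prodMk {g : α → γ} (hf : TimeIn κ f) (hg : TimeIn κ g) :
    TimeIn κ fun a => (f a, g a) := by
  obtain ⟨P, p, hP⟩ := hf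
  obtain ⟨Q, q, hQ⟩ := hg
  refine ⟨.both P Q, p + q + 1, fun a => ?_⟩
  obtain ⟨s, runP, hs⟩ := hP a
  obtain ⟨t, runQ, ht⟩ := hQ a
  refine ⟨_, .both runP runQ, ?_⟩
  simp only [Polynomial.eval_add, Polynomial.eval_one]
  omega

theorem mono {κ' : α → ℕ} (hf : TimeIn κ f) (h : ∀ a, κ a ≤ κ' a) : TimeIn κ' f := by
  obtain ⟨P, q, hP⟩ := hf
  refine ⟨P, q, fun a => ?_⟩
  obtain ⟨t, run, ht⟩ := hP a
  exact ⟨t, run, ht.trans (monotone_polynomial_eval q (h a))⟩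

end TimeIn

theorem exists_runs_const (x : Val) :
    ∃ (P : Prog) (k : ℕ), ∀ y : Val, ∃ t, Runs P y x t ∧ t ≤ k * y.size + k := by
  induction x with
  | nat n =>
    refine ⟨.op (.const n), (Val.nat n).size + 1, fun y => ⟨_, .op rfl, ?_⟩⟩
    nlinarith [y.size_pos, (Val.nat n).size_pos]
  | pair a b iha ihb =>
    obtain ⟨P, k, hP⟩ := iha
    obtain ⟨Q, m, hQ⟩ := ihb
    refine ⟨.both P Q, k + m + 1, fun y => ?_⟩
    obtain ⟨s, runP, hs⟩ := hP y
    obtain ⟨t, runQ, ht⟩ := hQ y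
    exact ⟨_, .both runP runQ, by nlinarith⟩

namespace PolyTime

theorem of_op {f : α → β} (o : Op) (h : ∀ a, o.apply (enc a) = some (enc (f a)))
    (hsize : ∀ a, bitSize (f a) ≤ bitSize a) : PolyTime f :=
  ⟨.op o, 2 * Polynomial.X, fun a => ⟨_, .op (h a), by
    have := hsize a
    simp only [bitSize, Polynomial.eval_mul, Polynomial.eval_ofNat, Polynomial.eval_X] at *
    omega⟩⟩

@[fun_prop]
theorem id : PolyTime fun a : α => a := of_op .id (fun _ => rfl) fun _ => le_rfl

@[fun_prop]
theorem comp {f : α → β} {g : β → γ} (hg : PolyTime g) (hf : PolyTime f) :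
    PolyTime fun a => g (f a) := TimeIn.comp hg hf

@[fun_prop]
theorem prodMk {f : α → β} {g : α → γ} (hf : PolyTime f) (hg : PolyTime g) :
    PolyTime fun a => (f a, g a) := TimeIn.prodMk hf hg

@[fun_prop]
theorem const (b : β) : PolyTime fun _ : α => b := by
  obtain ⟨P, k, hP⟩ := exists_runs_const (enc b)
  refine ⟨P, (k : Polynomial ℕ) * Polynomial.X + (k : Polynomial ℕ), fun a => ?_⟩
  obtain ⟨t, run, ht⟩ := hP (enc a)
  exact ⟨t, run, by simpa [bitSize] using ht⟩

@[fun_prop]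
theorem fst {f : α → β × γ} (hf : PolyTime f) : PolyTime fun a => (f a).1 :=
  comp (of_op (f := Prod.fst) .fst (fun _ => rfl) fun p => by rw [bitSize_prod]; omega) hf

@[fun_prop]
theorem snd {f : α → β × γ} (hf : PolyTime f) : PolyTime fun a => (f a).2 :=
  comp (of_op (f := Prod.snd) .snd (fun _ => rfl) fun p => by rw [bitSize_prod]; omega) hf

theorem natBinop {f g : α → ℕ} (hf : PolyTime f) (hg : PolyTime g) (o : Op) (op : ℕ → ℕ → ℕ)
    (ho : ∀ a b, o.apply (.pair (.nat a) (.nat b)) = some (.nat (op a b)))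
    (hsize : ∀ a b, bitSize (op a b) ≤ bitSize a + bitSize b) :
    PolyTime fun x => op (f x) (g x) :=
  comp (g := fun p : ℕ × ℕ => op p.1 p.2)
    (of_op o (fun p => ho p.1 p.2) fun p => (hsize p.1 p.2).trans (Nat.le_succ _)) (hf.prodMk hg)

@[fun_prop]
theorem add {f g : α → ℕ} (hf : PolyTime f) (hg : PolyTime g) : PolyTime fun a => f a + g a :=
  natBinop hf hg .add _ (fun _ _ => rfl) bitSize_add_le

@[fun_prop]
theorem mul {f g : α → ℕ} (hf : PolyTime f) (hg : PolyTime g) : PolyTime fun a => f a * g a :=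
  natBinop hf hg .mul _ (fun _ _ => rfl) bitSize_mul_le

@[fun_prop]
theorem sub {f g : α → ℕ} (hf : PolyTime f) (hg : PolyTime g) : PolyTime fun a => f a - g a :=
  natBinop hf hg .sub _ (fun _ _ => rfl) fun a b =>
    (bitSize_mono (Nat.sub_le a b)).trans (Nat.le_add_right _ _)

@[fun_prop]
theorem div {f g : α → ℕ} (hf : PolyTime f) (hg : PolyTime g) : PolyTime fun a => f a / g a :=
  natBinop hf hg .div _ (fun _ _ => rfl) fun a b =>
    (bitSize_mono (Nat.div_le_self a b)).trans (Nat.le_add_right _ _)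

@[fun_prop]
theorem mod {f g : δ → ℕ} (hf : PolyTime f) (hg : PolyTime g) : PolyTime fun x => f x % g x := by
  simp only [Nat.mod_eq_sub]
  fun_prop

@[fun_prop]
theorem pow {f : δ → ℕ} (hf : PolyTime f) (k : ℕ) : PolyTime fun x => f x ^ k := by
  induction k with
  | zero => simp only [pow_zero]; fun_prop
  | succ k ih => simp only [pow_succ]; fun_prop

@[fun_prop]
theorem cons {f : α → β} {g : α → List β} (hf : PolyTime f) (hg : PolyTime g) :
    PolyTime fun a => f a :: g a := hf.prodMk hg

@[fun_prop]
theorem some {f : α → β} (hf : PolyTime f) : PolyTime fun a => Option.some (f a) :=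
  hf.prodMk (const (0 : ℕ))

@[fun_prop]
theorem toList {o : α → Option β} (ho : PolyTime o) : PolyTime fun a => (o a).toList := ho

theorem branch {c : α → β} {f : α → γ} (hc : PolyTime c) {P Q : Prog} {p q : Polynomial ℕ}
    (hP : ∀ a, enc (c a) ≠ .nat 0 → ∃ t, Runs P (enc a) (enc (f a)) t ∧ t ≤ p.eval (bitSize a))
    (hQ : ∀ a, enc (c a) = .nat 0 → ∃ t, Runs Q (enc a) (enc (f a)) t ∧ t ≤ q.eval (bitSize a)) :
    PolyTime f := by
  obtain ⟨C, r, hC⟩ := hc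
  refine ⟨.ite C P Q, r + p + q + 1, fun a => ?_⟩
  obtain ⟨s, runC, hs⟩ := hC a
  simp only [Polynomial.eval_add, Polynomial.eval_one]
  by_cases h0 : enc (c a) = .nat 0
  · obtain ⟨t, runQ, ht⟩ := hQ a h0
    exact ⟨_, .ite_false (h0 ▸ runC) runQ, by omega⟩
  · obtain ⟨t, runP, ht⟩ := hP a h0
    exact ⟨_, .ite_true runC h0 runP, by omega⟩

@[fun_prop]
theorem ite_le {a b : α → ℕ} {f g : α → β} (ha : PolyTime a) (hb : PolyTime b) (hf : PolyTime f)
    (hg : PolyTime g) : PolyTime fun x => if a x ≤ b x then f x else g x := by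
  obtain ⟨P, p, hP⟩ := hf
  obtain ⟨Q, q, hQ⟩ := hg
  refine branch (c := fun x => a x - b x) (by fun_prop) (P := Q) (Q := P) (p := q) (q := p)
    (fun x hx => ?_) (fun x hx => ?_)
  · have : ¬ a x ≤ b x := fun h => hx (by simp [Nat.sub_eq_zero_of_le h])
    simpa only [this, if_false] using hQ x
  · have : a x ≤ b x := by simpa [Nat.sub_eq_zero_iff_le] using hx
    simpa only [this, if_true] using hP x

@[fun_prop]
theorem min {f g : δ → ℕ} (hf : PolyTime f) (hg : PolyTime g) :
    PolyTime fun x => min (f x) (g x) := by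
  simp only [min_def]
  fun_prop

@[fun_prop]
theorem max {f g : δ → ℕ} (hf : PolyTime f) (hg : PolyTime g) :
    PolyTime fun x => max (f x) (g x) := by
  simp only [max_def]
  fun_prop

@[fun_prop]
theorem optionElim {o : α → Option β} {x : α → γ} {f : α → β → γ} (ho : PolyTime o)
    (hx : PolyTime x) (hf : PolyTime fun p : α × β => f p.1 p.2) :
    PolyTime fun a => (o a).elim (x a) (f a) := by
  obtain ⟨P, p, hP⟩ := hx
  -- `some b` and `(b, 0)` are represented by the same datum.
  obtain ⟨Q, q, hQ⟩ : PolyTime fun p : α × (β × ℕ) => f p.1 p.2.1 :=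
    hf.comp (f := fun p : α × (β × ℕ) => (p.1, p.2.1)) (by fun_prop)
  obtain ⟨S, s, hS⟩ := (PolyTime.id (α := α)).prodMk ho
  refine branch (c := o) ho (P := .seq S Q) (Q := P) (p := s + q.comp s + 1) (q := p)
    (fun a ha => ?_) (fun a ha => ?_)
  · cases hoa : o a with
    | none => simp [hoa] at ha
    | some b =>
      obtain ⟨t, runS, ht⟩ := hS a
      obtain ⟨u, runQ, hu⟩ := hQ (a, (b, 0))
      beta_reduce at runS
      rw [hoa] at runS
      refine ⟨_, .seq runS runQ, ?_⟩
      have hu' := hu.trans (monotone_polynomial_eval q (runS.size_le.2.trans ht))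
      simp only [Polynomial.eval_add, Polynomial.eval_comp, Polynomial.eval_one] at hu' ⊢
      omega
  · cases hoa : o a with
    | none => simpa using hP a
    | some b => simp [hoa] at ha

@[fun_prop]
theorem next? {l : α → List β} (hl : PolyTime l) : PolyTime fun a => (l a).next? := by
  obtain ⟨P, p, hP⟩ := hl.prodMk (const (0 : ℕ))
  obtain ⟨Q, q, hQ⟩ := const (α := α) (0 : ℕ)
  refine branch (c := l) hl (P := P) (Q := Q) (p := p) (q := q) (fun a ha => ?_) (fun a ha => ?_)
  · cases hla : l a with
    | nil => simp [hla] at ha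
    | cons b m => simpa [hla] using hP a
  · cases hla : l a with
    | nil => simpa using hQ a
    | cons b m => simp [hla] at ha

end PolyTime

open PolyTime

theorem exists_runs_loop {c : σ → β} {f : σ → σ} (hc : PolyTime c) (hf : PolyTime f) :
    ∃ (P : Prog) (q : Polynomial ℕ), ∀ (n : ℕ) (s : σ) (B : ℕ),
      (∀ i < n, enc (c (f^[i] s)) ≠ .nat 0) → enc (c (f^[n] s)) = .nat 0 →
      (∀ i ≤ n, bitSize (f^[i] s) ≤ B) →
      ∃ t, Runs P (enc s) (enc (f^[n] s)) t ∧ t ≤ (n + 1) * q.eval B := by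
  obtain ⟨C, p, hC⟩ := hc
  obtain ⟨F, q, hF⟩ := hf
  refine ⟨.loop C F, p + q + 1, fun n => ?_⟩
  induction n with
  | zero =>
    intro s B _ halt hB
    obtain ⟨t, run, ht⟩ := hC s
    rw [Function.iterate_zero_apply] at halt
    refine ⟨_, .loop_done (halt ▸ run), ?_⟩
    have ht' := ht.trans (monotone_polynomial_eval p (hB 0 le_rfl))
    simp only [Polynomial.eval_add, Polynomial.eval_one] at ht' ⊢
    omega
  | succ n ih =>
    intro s B go halt hB
    obtain ⟨r, runC, hr⟩ := hC s
    obtain ⟨u, runF, hu⟩ := hF s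
    obtain ⟨t, run, ht⟩ := ih (f s) B (fun i hi => go (i + 1) (by omega)) halt
      fun i hi => hB (i + 1) (by omega)
    refine ⟨_, .loop_step runC (go 0 n.succ_pos) runF run, ?_⟩
    have hs := hB 0 (Nat.zero_le _)
    have hr' := hr.trans (monotone_polynomial_eval p hs)
    have hu' := hu.trans (monotone_polynomial_eval q hs)
    rw [Nat.add_mul (n + 1), one_mul]
    simp only [Polynomial.eval_add, Polynomial.eval_one] at hr' hu' ht ⊢
    omega

theorem TimeIn.iterate {κ : δ → ℕ} {s : δ → σ} {c : σ → β} {f : σ → σ} (hs : TimeIn κ s)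
    (hc : PolyTime c) (hf : PolyTime f) (n : δ → ℕ) (N B : Polynomial ℕ)
    (go : ∀ x, ∀ i < n x, enc (c (f^[i] (s x))) ≠ .nat 0)
    (halt : ∀ x, enc (c (f^[n x] (s x))) = .nat 0) (hN : ∀ x, n x ≤ N.eval (κ x))
    (hB : ∀ x, ∀ i ≤ n x, bitSize (f^[i] (s x)) ≤ B.eval (κ x)) :
    TimeIn κ fun x => f^[n x] (s x) := by
  obtain ⟨P, p, hP⟩ := hs
  obtain ⟨L, q, hL⟩ := exists_runs_loop hc hf
  refine ⟨.seq P L, p + (N + 1) * q.comp B + 1, fun x => ?_⟩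
  obtain ⟨r, runP, hr⟩ := hP x
  obtain ⟨t, runL, ht⟩ := hL (n x) (s x) _ (go x) (halt x) (hB x)
  refine ⟨_, .seq runP runL, ?_⟩
  have := Nat.mul_le_mul_right (q.eval (B.eval (κ x))) (Nat.add_le_add_right (hN x) 1)
  simp only [Polynomial.eval_add, Polynomial.eval_mul, Polynomial.eval_comp,
    Polynomial.eval_one] at this ⊢
  omega

theorem TimeIn.foldl {κ : δ → ℕ} {c : δ → γ} {l : δ → List α} {s : δ → σ}
    {step : γ → σ → α → σ} (hstep : PolyTime fun p : γ × σ × α => step p.1 p.2.1 p.2.2)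
    (hc : TimeIn κ c) (hl : TimeIn κ l) (hs : TimeIn κ s) (B : Polynomial ℕ)
    (hB : ∀ x l', l' <+: l x → bitSize (l'.foldl (step (c x)) (s x)) ≤ B.eval (κ x)) :
    TimeIn κ fun x => (l x).foldl (step (c x)) (s x) := by
  obtain ⟨q₁, hq₁⟩ := hc.bitSize_le
  obtain ⟨q₂, hq₂⟩ := hl.bitSize_le
  have hf : PolyTime (foldlStep step) := by
    have := hstep.comp (f := fun p : (γ × List α × σ) × α × List α => (p.1.1, p.1.2.2, p.2.1))
      (by fun_prop)
    unfold foldlStep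
    fun_prop
  have loop := TimeIn.iterate (hc.prodMk (hl.prodMk hs)) (c := fun p => p.2.1) (by fun_prop) hf
    (fun x => (l x).length) q₂ (q₁ + q₂ + B + 2) (fun x i hi => ?_) (fun x => ?_)
    (fun x => (length_lt_bitSize _).le.trans (hq₂ x)) fun x i hi => ?_
  · simpa [iterate_foldlStep] using TimeIn.comp (g := fun p => p.2.2) (by fun_prop) loop
  · simp only [iterate_foldlStep step _ _ hi.le]
    cases h : (l x).drop i with
    | nil => have := List.drop_eq_nil_iff.1 h; omega
    | cons a m => simp
  · simp [iterate_foldlStep]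
  · simp only [iterate_foldlStep step _ _ hi, bitSize_pair, Polynomial.eval_add,
      Polynomial.eval_ofNat]
    have := hq₁ x
    have := (bitSize_le_of_suffix (List.drop_suffix i (l x))).trans (hq₂ x)
    have := hB x _ (List.take_prefix i (l x))
    omega

theorem iterate_pred_cons (n i : ℕ) (hi : i ≤ n) :
    (fun p : ℕ × List ℕ => (p.1 - 1, (p.1 - 1) :: p.2))^[i] (n, []) =
      (n - i, List.range' (n - i) i) := by
  induction i with
  | zero => simp
  | succ i ih =>
    rw [Function.iterate_succ_apply', ih (by omega), List.range'_succ, Nat.sub_sub,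
      show n - (i + 1) + 1 = n - i by omega]

theorem TimeIn.range {κ : δ → ℕ} {n : δ → ℕ} (hn : TimeIn κ n) (N : Polynomial ℕ)
    (hN : ∀ x, n x ≤ N.eval (κ x)) : TimeIn κ fun x => List.range (n x) := by
  have loop := TimeIn.iterate
    (TimeIn.comp (g := fun m : ℕ => (m, ([] : List ℕ))) (by fun_prop) hn)
    (c := fun p => p.1) (f := fun p => (p.1 - 1, (p.1 - 1) :: p.2)) (by fun_prop) (by fun_prop)
    n N (N + 1 + (N * (N + 2) + 1) + 1) (fun x i hi => ?_) (fun x => ?_) hN fun x i hi => ?_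
  · simpa [iterate_pred_cons, List.range_eq_range'] using
      TimeIn.comp (g := fun p => p.2) (by fun_prop) loop
  · simp only [iterate_pred_cons _ _ hi.le, enc_nat, ne_eq, Val.nat.injEq]
    omega
  · simp [iterate_pred_cons]
  · have size_counter := bitSize_le_succ (n x - i)
    have size_list : bitSize (List.range' (n x - i) i) ≤ i * (n x + 2) + 1 := by
      refine (bitSize_list_le (B := n x + 1) fun a ha => ?_).trans (by simp)
      have := bitSize_le_succ a
      have := List.mem_range'_1.1 ha
      omega
    have : i * (n x + 2) ≤ N.eval (κ x) * (N.eval (κ x) + 2) := by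
      have := hN x
      gcongr
      exact hi.trans this
    have := hN x
    simp only [iterate_pred_cons _ _ hi, bitSize_pair, Polynomial.eval_add, Polynomial.eval_mul,
      Polynomial.eval_ofNat, Polynomial.eval_one]
    omega

namespace PolyTime

@[fun_prop]
theorem getD {o : δ → Option α} {f : δ → α} (ho : PolyTime o) (hf : PolyTime f) :
    PolyTime fun x => (o x).getD (f x) := by
  have : ∀ x, (o x).getD (f x) = (o x).elim (f x) fun a => a := fun x => by cases o x <;> rfl
  simp only [this]
  fun_prop

@[fun_prop]
theorem ite_lt {a b : α → ℕ} {f g : α → β} (ha : PolyTime a) (hb : PolyTime b) (hf : PolyTime f)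
    (hg : PolyTime g) : PolyTime fun x => if a x < b x then f x else g x := by
  simp only [← not_le, ite_not]
  fun_prop

theorem foldl {l : δ → List α} {s : δ → σ} {step : δ → σ → α → σ} (hl : PolyTime l)
    (hs : PolyTime s) (hstep : PolyTime fun p : δ × σ × α => step p.1 p.2.1 p.2.2)
    (q : Polynomial ℕ)
    (hq : ∀ x s a, bitSize (step x s a) ≤ bitSize s + q.eval (bitSize x + bitSize a)) :
    PolyTime fun x => (l x).foldl (step x) (s x) := by
  obtain ⟨L, hL⟩ := hl.bitSize_le
  obtain ⟨S, hS⟩ := hs.bitSize_le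
  refine TimeIn.foldl hstep PolyTime.id hl hs (S + L * q.comp (Polynomial.X + L))
    fun x l' hl' => ?_
  refine (bitSize_foldl_le (b := q.eval (bitSize x + L.eval (bitSize x)))
    (fun s a ha => (hq x s a).trans ?_) _).trans ?_
  · have := (bitSize_le_of_mem (hl'.subset ha)).trans (hL x)
    exact Nat.add_le_add_left (monotone_polynomial_eval q (by omega)) _
  · simp only [Polynomial.eval_add, Polynomial.eval_mul, Polynomial.eval_comp, Polynomial.eval_X]
    have := hl'.length_le.trans ((length_lt_bitSize (l x)).le.trans (hL x))
    gcongr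
    exact hS x

@[fun_prop]
theorem reverse {l : δ → List α} (hl : PolyTime l) : PolyTime fun x => (l x).reverse := by
  have := foldl (step := fun _ (m : List α) a => a :: m) hl (const []) (by fun_prop)
    (Polynomial.X + 1) fun x m a => by simp; omega
  simpa only [List.foldl_flip_cons_eq_append', List.append_nil] using this

@[fun_prop]
theorem map {l : δ → List α} {f : δ → α → β} (hl : PolyTime l)
    (hf : PolyTime fun p : δ × α => f p.1 p.2) : PolyTime fun x => (l x).map (f x) := by
  obtain ⟨q, hq⟩ := hf.bitSize_le
  have := foldl (step := fun x (m : List β) a => f x a :: m) hl (const [])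
    ((hf.comp (f := fun p : δ × List β × α => (p.1, p.2.2)) (by fun_prop)).cons (by fun_prop))
    (q.comp (Polynomial.X + 1) + 1) fun x m a => by
      have := hq (x, a)
      simp only [bitSize_cons, bitSize_pair, Polynomial.eval_add, Polynomial.eval_comp,
        Polynomial.eval_X, Polynomial.eval_one] at this ⊢
      omega
  simpa only [List.foldl_flip_cons_eq_append, List.append_nil, List.reverse_reverse] using
    reverse this

@[fun_prop]
theorem append {l m : δ → List α} (hl : PolyTime l) (hm : PolyTime m) :
    PolyTime fun x => l x ++ m x := by
  have := foldl (step := fun _ (m : List α) a => a :: m) (reverse hl) hm (by fun_prop)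
    (Polynomial.X + 1) fun x m a => by simp; omega
  simpa only [List.foldl_flip_cons_eq_append', List.reverse_reverse] using this

@[fun_prop]
theorem flatten {l : δ → List (List α)} (hl : PolyTime l) :
    PolyTime fun x => (l x).flatten := by
  have := foldl (step := fun _ (m k : List α) => m ++ k) hl (const []) (by fun_prop)
    Polynomial.X fun x m k => by
      have := bitSize_append m k
      rw [Polynomial.eval_X]
      omega
  have foldl_append (l : List (List α)) : l.foldl (fun m k => m ++ k) [] = l.flatten := by
    simpa using List.foldl_append_eq_append (l := l) (f := fun m => m) (l' := [])
  simpa only [foldl_append] using this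

@[fun_prop]
theorem flatMap {l : δ → List α} {f : δ → α → List β} (hl : PolyTime l)
    (hf : PolyTime fun p : δ × α => f p.1 p.2) : PolyTime fun x => (l x).flatMap (f x) := by
  simp only [List.flatMap_def]
  fun_prop

@[fun_prop]
theorem sum {l : δ → List ℕ} (hl : PolyTime l) : PolyTime fun x => (l x).sum := by
  simp only [List.sum_eq_foldl]
  exact foldl (step := fun _ s a => s + a) hl (const 0) (by fun_prop) Polynomial.X fun x s a => by
    have := bitSize_add_le s a
    rw [Polynomial.eval_X]
    omega

@[fun_prop]
theorem prod {l : δ → List ℕ} (hl : PolyTime l) : PolyTime fun x => (l x).prod := by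
  simp only [List.prod_eq_foldl]
  exact foldl (step := fun _ s a => s * a) hl (const 1) (by fun_prop) Polynomial.X fun x s a => by
    have := bitSize_mul_le s a
    rw [Polynomial.eval_X]
    omega

@[fun_prop]
theorem length {l : δ → List α} (hl : PolyTime l) : PolyTime fun x => (l x).length := by
  have := sum (map (f := fun _ _ => 1) hl (by fun_prop))
  simpa using this

@[fun_prop]
theorem min? {l : δ → List ℕ} (hl : PolyTime l) : PolyTime fun x => (l x).min? := by
  have min?_eq (l : List ℕ) :
      l.min? = l.next?.elim none fun p => Option.some (p.2.foldl Min.min p.1) := by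
    cases l <;> rfl
  have : PolyTime fun p : ℕ × List ℕ => p.2.foldl Min.min p.1 :=
    foldl (step := fun _ => Min.min) (by fun_prop) (by fun_prop) (by fun_prop) Polynomial.X
      fun x s a => (bitSize_mono (min_le_left s a)).trans (Nat.le_add_right _ _)
  simp only [min?_eq]
  fun_prop

@[fun_prop]
theorem max? {l : δ → List ℕ} (hl : PolyTime l) : PolyTime fun x => (l x).max? := by
  have max?_eq (l : List ℕ) :
      l.max? = l.next?.elim none fun p => Option.some (p.2.foldl Max.max p.1) := by
    cases l <;> rfl
  have : PolyTime fun p : ℕ × List ℕ => p.2.foldl Max.max p.1 :=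
    foldl (step := fun _ => Max.max) (by fun_prop) (by fun_prop) (by fun_prop) Polynomial.X
      fun x s a => by
        rcases max_choice s a with h | h <;> rw [h, Polynomial.eval_X] <;> omega
  simp only [max?_eq]
  fun_prop

@[fun_prop]
theorem argmax {l : δ → List α} {key : δ → α → ℕ} (hl : PolyTime l)
    (hkey : PolyTime fun p : δ × α => key p.1 p.2) : PolyTime fun x => (l x).argmax (key x) := by
  have step : ∀ x (o : Option α) a, List.argAux (fun b c => key x c < key x b) o a =
      o.elim (Option.some a) fun c => if key x c < key x a then Option.some a else Option.some c :=
    fun x o a => by cases o <;> rfl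
  have := hkey.comp (f := fun p : (δ × Option α × α) × α => (p.1.1, p.2)) (by fun_prop)
  have := hkey.comp (f := fun p : (δ × Option α × α) × α => (p.1.1, p.1.2.2)) (by fun_prop)
  refine foldl hl (const none) ?_ (Polynomial.X + 2) fun x o a => ?_
  · simp only [step]
    fun_prop
  · rw [step]
    cases o <;> simp only [Option.elim] <;> (try split_ifs) <;> simp <;> omega

@[fun_prop]
theorem zip {l : δ → List α} {m : δ → List β} (hl : PolyTime l) (hm : PolyTime m) :
    PolyTime fun x => (l x).zip (m x) := by
  let step (s : List β × List (α × β)) (a : α) : List β × List (α × β) :=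
    s.1.next?.elim s fun bk => (bk.2, (a, bk.1) :: s.2)
  have foldl_step (l : List α) (m : List β) (k) :
      (l.foldl step (m, k)).2 = (l.zip m).reverse ++ k := by
    induction l generalizing m k with
    | nil => simp
    | cons a l ih =>
      cases m with
      | nil => simpa [step] using ih [] k
      | cons b m => simpa [step] using ih m ((a, b) :: k)
  have fold := foldl (step := fun _ => step) hl (hm.prodMk (const [])) (by fun_prop)
    (Polynomial.X + 10) fun x s a => by
      rcases s with ⟨_ | ⟨b, m⟩, k⟩
      · simp [step]
      · simp [step]; omega
  simpa [foldl_step] using reverse (snd fold)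

end PolyTime

end BitCost

namespace UnitDemand

open BitCost

/-- The rank of an item with value level `a` and price level `c ≤ C` in the order of the buyer's
preferences: by the level of the utility, and then by the price level. Items that are not bought
have rank `0`. -/
def levelRank (C a c : ℕ) : ℕ := if c ≤ a then (a - c) * (C + 1) + c else 0

namespace Scheme

/-- An item in integers: its mass points, given by their values and their weights. -/
abbrev Item := List (ℕ × ℕ)

/-- The weight of the mass points of an item that are at least `y`. -/
def tailWeight (item : Item) (y : ℕ) : ℕ :=
  (item.map fun x => if y ≤ x.1 then x.2 else 0).sum

/-- The best revenue from selling an item alone at a price above `H`, where the weights of the item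
add up to `D`. -/
def tailRevenue (D H : ℕ) (item : Item) : ℕ :=
  (item.map fun x => if x.1 ≤ H then 0 else x.1 * tailWeight item x.1 / D).max?.getD 0

/-- An upper bound on the optimal revenue, tight up to a factor of four: the least sum of a
threshold `H` and of the revenues from selling the items separately above `H`. -/
def scale (D : ℕ) (inst : List Item) : ℕ :=
  ((0 :: inst.flatten.map Prod.fst).map fun H =>
    H + (inst.map (tailRevenue D H)).sum).min?.getD 0

/-- The value level of `x`, in units of `E / r ^ 2`; values above `r ^ 3 * E` are exceptional. -/
def level (r E x : ℕ) : ℕ := min (x * r ^ 2 / E) (r ^ 5)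

/-- The rank of an item with value `x` at price level `c`. -/
def rank (r E x c : ℕ) : ℕ := levelRank (r ^ 4) (level r E x) c

/-- The weight of the mass points of rank at most `k`. -/
def rankWeight (r E : ℕ) (item : Item) (c k : ℕ) : ℕ :=
  (item.map fun x => if rank r E x.1 c ≤ k then x.2 else 0).sum

/-- A way to price an item: the distribution function of its rank, the separate revenue, and the
price, as a fraction. -/
structure Choice where
  cdf : List ℕ
  bonus : ℕ
  price : ℕ × ℕ

instance : Enc Choice := ⟨fun o => Enc.enc (o.cdf, o.bonus, o.price)⟩

/-- Pricing an item at a price level. -/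
def lowChoice (r E D : ℕ) (ranks : List ℕ) (item : Item) (c : ℕ) : Choice where
  cdf := ranks.map (rankWeight r E item c)
  bonus := 0
  price := ((r - 1) * E * c, r * r ^ 2 * D ^ 2)

/-- Pricing an item so high that only exceptional values matter. -/
def highChoice (r E D : ℕ) (ranks : List ℕ) (item : Item) (x : ℕ) : Choice where
  cdf := ranks.map fun _ => D
  bonus := max x (r ^ 2 * E) * tailWeight item (max x (r ^ 2 * E))
  price := ((r - 1) * max x (r ^ 2 * E), r * D ^ 2)

/-- The ways to price an item that the dynamic program considers. -/
def choices (r E D : ℕ) (levels ranks : List ℕ) (item : Item) : List Choice :=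
  (levels.map fun c => lowChoice r E D ranks item c) ++
    item.map fun x => highChoice r E D ranks item x.1

/-- A state of the dynamic program: the rounded distribution function of the largest rank, the
separate revenue and the prices of the items treated so far. -/
structure State where
  cdf : List ℕ
  bonus : ℕ
  prices : List (ℕ × ℕ)

instance : Enc State := ⟨fun e => Enc.enc (e.cdf, e.bonus, e.prices)⟩

/-- The state after one more item. The rank distribution of the item has weights out of `D`. -/
def extend (D : ℕ) (e : State) (o : Choice) : State where
  cdf := (e.cdf.zip o.cdf).map fun y => y.1 * y.2 / D
  bonus := e.bonus + o.bonus
  prices := o.price :: e.prices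

/-- The `ℓ¹` distance of two vectors; truncated subtraction is used in both directions. -/
def distance (v w : List ℕ) : ℕ := ((v.zip w).map fun y => y.1 - y.2 + (y.2 - y.1)).sum

/-- The extensions of the states whose distribution function is `z`. -/
def extensions (D : ℕ) (opts : List Choice) (states : List State) (z : List ℕ) : List State :=
  (states.flatMap fun e => opts.map (extend D e)).flatMap fun e =>
    if distance e.cdf z ≤ 0 then [⟨z, e.bonus, e.prices⟩] else []

/-- One round of the dynamic program: all extensions of the states, of which only one with the
largest separate revenue is kept for each vector of `Z`. -/
def round (D : ℕ) (Z : List (List ℕ)) (opts : List Choice) (states : List State) : List State :=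
  Z.flatMap fun z => ((extensions D opts states z).argmax State.bonus).toList

/-- The state before the first item, with the distribution function that is constant equal to the
resolution `M`. -/
def start (M : ℕ) (ranks : List ℕ) : State := ⟨ranks.map fun _ => M, 0, []⟩

/-- The states of the dynamic program after all items. -/
def states (D M : ℕ) (ranks : List ℕ) (Z : List (List ℕ)) (opts : List (List Choice)) :
    List State :=
  opts.foldr (round D Z) [start M ranks]

/-- The expected price level of the item of largest rank, for the distribution function `v` of the
largest rank. -/
def meanLevel (r : ℕ) (ranks v : List ℕ) : ℕ :=
  ((ranks.zip (v.zip (0 :: v))).map fun y => y.1 % (r ^ 4 + 1) * (y.2.1 - y.2.2)).sum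

/-- The estimate of the revenue of a state, multiplied by a common denominator. -/
def merit (r E D M : ℕ) (ranks : List ℕ) (e : State) : ℕ :=
  e.bonus * r ^ 2 * M + E * D * meanLevel r ranks e.cdf

/-- The prices that the dynamic program finds. -/
def prices (r E D M : ℕ) (levels ranks : List ℕ) (Z : List (List ℕ)) (inst : List Item) :
    List (ℕ × ℕ) :=
  ((states D M ranks Z (inst.map (choices r E D levels ranks))).argmax
    (merit r E D M ranks)).elim [] State.prices

/-- An instance as a list over the items of their mass points, whose values and probabilities are
given as fractions. -/
abbrev Raw := List (List ((ℕ × ℕ) × (ℕ × ℕ)))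

/-- A common denominator of an instance. -/
def denom (I : Raw) : ℕ := (I.flatten.map fun x => x.1.2 * x.2.2).prod

/-- The instance in integers: the values are multiplied by the square of the common denominator, so
that revenues are divisible by it, and the probabilities by the common denominator. -/
def integral (I : Raw) : List Item :=
  I.map fun item => item.map fun x => (denom I ^ 2 * x.1.1 / x.1.2, denom I * x.2.1 / x.2.2)

/-- The accuracy parameter `r` for the relative error `e.1 / e.2`. -/
def accuracy (e : ℕ × ℕ) : ℕ := 100 * (e.2 / e.1 + 1)

/-- A strict upper bound on all ranks. -/
def numRanks (r : ℕ) : ℕ := (r ^ 5 + 1) * (r ^ 4 + 1)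

/-- The denominator of the rounded probabilities of the dynamic program for `n` items. -/
def resolution (r n : ℕ) : ℕ := 2 * numRanks r * r ^ 3 * (n + 1)

/-- All vectors with entries from `R` of the length of `l`. -/
def vectors (R l : List ℕ) : List (List ℕ) :=
  l.foldl (fun Z _ => Z.flatMap fun v => R.map fun s => s :: v) [[]]

/-- The approximation scheme, applied to a relative error and an instance. -/
def solve (x : (ℕ × ℕ) × Raw) : List (ℕ × ℕ) :=
  prices (accuracy x.1) (scale (denom x.2) (integral x.2)) (denom x.2)
    (resolution (accuracy x.1) x.2.length) (List.range (accuracy x.1 ^ 4 + 1))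
    (List.range (numRanks (accuracy x.1)))
    (vectors (List.range (resolution (accuracy x.1) x.2.length + 1))
      (List.range (numRanks (accuracy x.1)))) (integral x.2)

section Time

variable {δ : Type} [Enc δ]

@[fun_prop]
theorem polyTime_tailWeight {item : δ → Item} {y : δ → ℕ} (hitem : PolyTime item)
    (hy : PolyTime y) : PolyTime fun x => tailWeight (item x) (y x) := by
  unfold tailWeight; fun_prop

@[fun_prop]
theorem polyTime_tailRevenue {D H : δ → ℕ} {item : δ → Item} (hD : PolyTime D)
    (hH : PolyTime H) (hitem : PolyTime item) :
    PolyTime fun x => tailRevenue (D x) (H x) (item x) := by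
  unfold tailRevenue; fun_prop

@[fun_prop]
theorem polyTime_scale {D : δ → ℕ} {inst : δ → List Item} (hD : PolyTime D)
    (hinst : PolyTime inst) : PolyTime fun x => scale (D x) (inst x) := by
  unfold scale; fun_prop

@[fun_prop]
theorem polyTime_rankWeight {r E c k : δ → ℕ} {item : δ → Item} (hr : PolyTime r)
    (hE : PolyTime E) (hitem : PolyTime item) (hc : PolyTime c) (hk : PolyTime k) :
    PolyTime fun x => rankWeight (r x) (E x) (item x) (c x) (k x) := by
  unfold rankWeight rank levelRank level; fun_prop

@[fun_prop]
theorem polyTime_choiceMk {v : δ → List ℕ} {b : δ → ℕ} {p : δ → ℕ × ℕ} (hv : PolyTime v)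
    (hb : PolyTime b) (hp : PolyTime p) : PolyTime fun x => Choice.mk (v x) (b x) (p x) :=
  hv.prodMk (hb.prodMk hp)

@[fun_prop]
theorem polyTime_choices {r E D : δ → ℕ} {levels ranks : δ → List ℕ} {item : δ → Item}
    (hr : PolyTime r) (hE : PolyTime E) (hD : PolyTime D) (hlevels : PolyTime levels)
    (hranks : PolyTime ranks) (hitem : PolyTime item) :
    PolyTime fun x => choices (r x) (E x) (D x) (levels x) (ranks x) (item x) := by
  unfold choices lowChoice highChoice; fun_prop

@[fun_prop]
theorem polyTime_stateMk {v : δ → List ℕ} {b : δ → ℕ} {p : δ → List (ℕ × ℕ)} (hv : PolyTime v)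
    (hb : PolyTime b) (hp : PolyTime p) : PolyTime fun x => State.mk (v x) (b x) (p x) :=
  hv.prodMk (hb.prodMk hp)

theorem polyTime_choice_toProd : PolyTime fun x : Choice => (x.cdf, x.bonus, x.price) :=
  PolyTime.id (α := Choice)

@[fun_prop]
theorem polyTime_choice_cdf : PolyTime Choice.cdf := polyTime_choice_toProd.fst

@[fun_prop]
theorem polyTime_choice_bonus : PolyTime Choice.bonus := polyTime_choice_toProd.snd.fst

@[fun_prop]
theorem polyTime_choice_price : PolyTime Choice.price := polyTime_choice_toProd.snd.snd

theorem polyTime_state_toProd : PolyTime fun x : State => (x.cdf, x.bonus, x.prices) :=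
  PolyTime.id (α := State)

@[fun_prop]
theorem polyTime_state_cdf : PolyTime State.cdf := polyTime_state_toProd.fst

@[fun_prop]
theorem polyTime_state_bonus : PolyTime State.bonus := polyTime_state_toProd.snd.fst

@[fun_prop]
theorem polyTime_state_prices : PolyTime State.prices := polyTime_state_toProd.snd.snd

@[fun_prop]
theorem polyTime_round {D : δ → ℕ} {Z : δ → List (List ℕ)} {opts : δ → List Choice}
    {s : δ → List State} (hD : PolyTime D) (hZ : PolyTime Z) (hopts : PolyTime opts)
    (hs : PolyTime s) : PolyTime fun x => round (D x) (Z x) (opts x) (s x) := by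
  unfold round extensions extend distance; fun_prop

@[fun_prop]
theorem polyTime_start {M : δ → ℕ} {ranks : δ → List ℕ} (hM : PolyTime M)
    (hranks : PolyTime ranks) : PolyTime fun x => start (M x) (ranks x) := by
  unfold start; fun_prop

@[fun_prop]
theorem polyTime_merit {r E D M : δ → ℕ} {ranks : δ → List ℕ} {e : δ → State}
    (hr : PolyTime r) (hE : PolyTime E) (hD : PolyTime D) (hM : PolyTime M)
    (hranks : PolyTime ranks) (he : PolyTime e) :
    PolyTime fun x => merit (r x) (E x) (D x) (M x) (ranks x) (e x) := by
  unfold merit meanLevel; fun_prop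

@[fun_prop]
theorem polyTime_denom {I : δ → Raw} (h : PolyTime I) : PolyTime fun x => denom (I x) := by
  unfold denom; fun_prop

@[fun_prop]
theorem polyTime_integral {I : δ → Raw} (h : PolyTime I) : PolyTime fun x => integral (I x) := by
  unfold integral; fun_prop

@[fun_prop]
theorem polyTime_accuracy {e : δ → ℕ × ℕ} (h : PolyTime e) :
    PolyTime fun x => accuracy (e x) := by
  unfold accuracy; fun_prop

@[fun_prop]
theorem polyTime_numRanks {r : δ → ℕ} (h : PolyTime r) : PolyTime fun x => numRanks (r x) := by
  unfold numRanks; fun_prop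

@[fun_prop]
theorem polyTime_resolution {r n : δ → ℕ} (hr : PolyTime r) (hn : PolyTime n) :
    PolyTime fun x => resolution (r x) (n x) := by
  unfold resolution; fun_prop

end Time

theorem bitSize_state (e : State) :
    bitSize e = bitSize e.cdf + (bitSize e.bonus + bitSize e.prices + 1) + 1 := rfl

theorem bitSize_choice (o : Choice) :
    bitSize o = bitSize o.cdf + (bitSize o.bonus + bitSize o.price + 1) + 1 := rfl

theorem mem_extensions {D : ℕ} {opts : List Choice} {s : List State} {z : List ℕ} {e : State} :
    e ∈ extensions D opts s z ↔ ∃ e' ∈ s, ∃ o ∈ opts, distance (extend D e' o).cdf z = 0 ∧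
      e = ⟨z, e'.bonus + o.bonus, o.price :: e'.prices⟩ := by
  simp only [extensions, List.mem_flatMap, List.mem_map, List.mem_ite_nil_right,
    List.mem_singleton, Nat.le_zero]
  constructor
  · rintro ⟨_, ⟨e', he', o, ho, rfl⟩, close, rfl⟩
    exact ⟨e', he', o, ho, close, rfl⟩
  · rintro ⟨e', he', o, ho, close, rfl⟩
    exact ⟨_, ⟨e', he', o, ho, rfl⟩, close, rfl⟩

theorem mem_round {D : ℕ} {Z : List (List ℕ)} {opts : List Choice} {s : List State} {e : State}
    (h : e ∈ round D Z opts s) : e.cdf ∈ Z ∧ e ∈ extensions D opts s e.cdf := by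
  simp only [round, List.mem_flatMap, Option.mem_toList] at h
  obtain ⟨z, hz, h⟩ := h
  have he := List.argmax_mem h
  obtain ⟨_, _, _, _, _, rfl⟩ := mem_extensions.1 he
  exact ⟨hz, he⟩

theorem length_round_le (D : ℕ) (Z : List (List ℕ)) (opts : List Choice) (s : List State) :
    (round D Z opts s).length ≤ Z.length := by
  rw [round, List.length_flatMap]
  calc _ ≤ (Z.map fun _ => 1).sum := List.sum_le_sum fun z _ => Option.length_toList_le
    _ = _ := by simp

theorem bitSize_foldl_round_le {D B N b : ℕ} {Z : List (List ℕ)} {l : List (List Choice)}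
    (hl : ∀ opts ∈ l, ∀ o ∈ opts, bitSize o ≤ B) (hZ : ∀ z ∈ Z, bitSize z ≤ B)
    (hN : Z.length ≤ N) {s : List State} (hs : s.length ≤ N)
    (hb : ∀ e ∈ s, bitSize e.cdf ≤ B ∧ bitSize e.bonus + bitSize e.prices ≤ b) :
    bitSize (l.foldl (fun s opts => round D Z opts s) s) ≤
      N * (B + b + l.length * B + 3) + 1 := by
  induction l generalizing s b with
  | nil =>
    refine (bitSize_list_le (B := B + b + 2) fun e he => ?_).trans ?_
    · have := hb e he
      rw [bitSize_state]
      omega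
    · simp only [List.foldl_nil, List.length_nil, zero_mul, add_zero]
      gcongr
  | cons opts l ih =>
    refine (ih (fun opts h => hl opts (List.mem_cons_of_mem _ h)) (b := b + B)
      ((length_round_le ..).trans hN) fun e he => ?_).trans (le_of_eq ?_)
    · obtain ⟨hz, he⟩ := mem_round he
      obtain ⟨e', he', o, ho, -, eq⟩ := mem_extensions.1 he
      refine ⟨hZ _ hz, ?_⟩
      have size_o := hl opts List.mem_cons_self o ho
      have := bitSize_add_le e'.bonus o.bonus
      have := (hb e' he').2
      rw [bitSize_choice] at size_o
      rw [eq, bitSize_cons]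
      dsimp only
      omega
    · simp only [List.length_cons]
      ring

section Time

variable {δ : Type} [Enc δ]

@[fun_prop]
theorem polyTime_states {D M : δ → ℕ} {ranks : δ → List ℕ} {Z : δ → List (List ℕ)}
    {opts : δ → List (List Choice)} (hD : PolyTime D) (hM : PolyTime M) (hranks : PolyTime ranks)
    (hZ : PolyTime Z) (hopts : PolyTime opts) :
    PolyTime fun x => states (D x) (M x) (ranks x) (Z x) (opts x) := by
  have hstart : PolyTime fun x => start (M x) (ranks x) := by fun_prop
  obtain ⟨q, hq⟩ := TimeIn.bitSize_le (hZ.prodMk (hopts.prodMk hstart))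
  simp only [states, List.foldr_eq_foldl_reverse]
  refine TimeIn.foldl (c := fun x => (D x, Z x)) (step := fun c s o => round c.1 c.2 o s)
    (by fun_prop) (hD.prodMk hZ) hopts.reverse (hstart.cons (PolyTime.const []))
    (q * (2 * q + q * q + 3) + 1) fun x l hl => ?_
  have bound := hq x
  simp only [bitSize_pair] at bound
  have length_l : l.length ≤ q.eval (bitSize x) := by
    have := hl.length_le
    rw [List.length_reverse] at this
    have := length_lt_bitSize (opts x)
    omega
  refine (bitSize_foldl_round_le (B := q.eval (bitSize x)) (N := q.eval (bitSize x))
    (b := q.eval (bitSize x)) (fun o ho c hc => ?_) (fun z hz => ?_) ?_ ?_ fun e he => ?_).trans ?_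
  · have := bitSize_le_of_mem hc
    have := bitSize_le_of_mem (List.mem_reverse.1 (hl.subset ho))
    omega
  · have := bitSize_le_of_mem hz
    dsimp only at hz this ⊢
    omega
  · have := length_lt_bitSize (Z x)
    dsimp only
    omega
  · simp only [List.length_singleton]
    omega
  · rw [List.mem_singleton] at he
    subst he
    rw [bitSize_state] at bound
    omega
  · simp only [Polynomial.eval_add, Polynomial.eval_mul, Polynomial.eval_ofNat,
      Polynomial.eval_one]
    have := Nat.mul_le_mul_right (q.eval (bitSize x)) length_l
    exact Nat.add_le_add_right (Nat.mul_le_mul le_rfl (by omega)) 1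

@[fun_prop]
theorem polyTime_prices {r E D M : δ → ℕ} {levels ranks : δ → List ℕ} {Z : δ → List (List ℕ)}
    {inst : δ → List Item} (hr : PolyTime r) (hE : PolyTime E) (hD : PolyTime D)
    (hM : PolyTime M) (hlevels : PolyTime levels) (hranks : PolyTime ranks) (hZ : PolyTime Z)
    (hinst : PolyTime inst) : PolyTime fun x =>
      prices (r x) (E x) (D x) (M x) (levels x) (ranks x) (Z x) (inst x) := by
  unfold prices; fun_prop

end Time

theorem vectors_append (R l : List ℕ) (a : ℕ) : vectors R (l ++ [a]) =
    (vectors R l).flatMap fun v => R.map fun s => s :: v := by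
  simp [vectors]

theorem length_vectors (R l : List ℕ) : (vectors R l).length = R.length ^ l.length := by
  induction l using List.reverseRecOn with
  | nil => simp [vectors]
  | append_singleton l a ih => simp [vectors_append, List.length_flatMap, ih, pow_succ]

theorem mem_vectors {R l v : List ℕ} :
    v ∈ vectors R l ↔ v.length = l.length ∧ ∀ s ∈ v, s ∈ R := by
  induction l using List.reverseRecOn generalizing v with
  | nil => simp +contextual [vectors]
  | append_singleton l a ih =>
    cases v with
    | nil => simp [vectors_append]
    | cons s w => simp [vectors_append, ih, and_assoc, and_comm, and_left_comm]

theorem bitSize_vectors_range_le {N c : ℕ} {l : List ℕ} (hN : N ≤ c) (hl : l.length ≤ c)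
    (hpow : N ^ l.length ≤ c) :
    bitSize (vectors (List.range N) l) ≤ c * (c * (c + 2) + 2) + 1 := by
  refine (bitSize_list_le (B := c * (c + 2) + 1) fun v hv => ?_).trans ?_
  · rw [mem_vectors] at hv
    refine (bitSize_list_le (B := c + 1) fun s hs => ?_).trans ?_
    · have := List.mem_range.1 (hv.2 s hs)
      have := bitSize_le_succ s
      omega
    · rw [hv.1]
      gcongr
  · rw [length_vectors, List.length_range]
    gcongr

/-- The measure in which the algorithm takes polynomial time. For a fixed relative error it is
polynomial in the size of the instance. -/
def cost (x : (ℕ × ℕ) × Raw) : ℕ :=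
  bitSize x + (resolution (accuracy x.1) x.2.length + 2) ^ (numRanks (accuracy x.1) + 2)

theorem resolution_le_cost (x : (ℕ × ℕ) × Raw) :
    resolution (accuracy x.1) x.2.length + 2 ≤ cost x :=
  (Nat.le_self_pow (by omega) _).trans (Nat.le_add_left _ _)

theorem numRanks_le_cost (x : (ℕ × ℕ) × Raw) : numRanks (accuracy x.1) + 2 ≤ cost x :=
  calc numRanks (accuracy x.1) + 2 ≤ 2 ^ (numRanks (accuracy x.1) + 2) := Nat.lt_two_pow_self.le
    _ ≤ (resolution (accuracy x.1) x.2.length + 2) ^ (numRanks (accuracy x.1) + 2) :=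
      Nat.pow_le_pow_left (by omega) _
    _ ≤ cost x := Nat.le_add_left _ _

theorem timeIn_cost {β : Type} [Enc β] {f : (ℕ × ℕ) × Raw → β} (hf : PolyTime f) :
    TimeIn cost f := TimeIn.mono hf fun _ => Nat.le_add_right _ _

theorem timeIn_levels : TimeIn cost fun x => List.range (accuracy x.1 ^ 4 + 1) :=
  (timeIn_cost (by fun_prop)).range Polynomial.X fun x => by
    have := numRanks_le_cost x
    have : accuracy x.1 ^ 4 + 1 ≤ numRanks (accuracy x.1) :=
      Nat.le_mul_of_pos_left _ (Nat.succ_pos _)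
    rw [Polynomial.eval_X]
    omega

theorem timeIn_ranks : TimeIn cost fun x => List.range (numRanks (accuracy x.1)) :=
  (timeIn_cost (by fun_prop)).range Polynomial.X fun x => by
    have := numRanks_le_cost x
    rw [Polynomial.eval_X]
    omega

theorem timeIn_vectors :
    TimeIn cost fun x => vectors (List.range (resolution (accuracy x.1) x.2.length + 1))
      (List.range (numRanks (accuracy x.1))) := by
  have entries : TimeIn cost fun x =>
      List.range (resolution (accuracy x.1) x.2.length + 1) :=
    (timeIn_cost (by fun_prop)).range Polynomial.X fun x => by
      have := resolution_le_cost x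
      rw [Polynomial.eval_X]
      omega
  refine TimeIn.foldl (step := fun (R : List ℕ) Z _ => Z.flatMap fun v => R.map fun s => s :: v)
    (s := fun _ => [[]]) (by fun_prop) entries timeIn_ranks (timeIn_cost (PolyTime.const [[]]))
    (Polynomial.X * (Polynomial.X * (Polynomial.X + 2) + 2) + 1) fun x l hl => ?_
  have length_l := hl.length_le
  rw [List.length_range] at length_l
  have := numRanks_le_cost x
  have := resolution_le_cost x
  simp only [Polynomial.eval_add, Polynomial.eval_mul, Polynomial.eval_ofNat,
    Polynomial.eval_one, Polynomial.eval_X]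
  refine bitSize_vectors_range_le (by omega) (by omega) ?_
  exact (Nat.pow_le_pow_left (by omega) _).trans
    ((Nat.pow_le_pow_right (by omega) (by omega)).trans (Nat.le_add_left _ _))

theorem timeIn_solve : TimeIn cost solve := by
  have : PolyTime fun y : ((ℕ × ℕ) × Raw) × (List ℕ × (List ℕ × List (List ℕ))) =>
      prices (accuracy y.1.1) (scale (denom y.1.2) (integral y.1.2)) (denom y.1.2)
        (resolution (accuracy y.1.1) y.1.2.length) y.2.1 y.2.2.1 y.2.2.2 (integral y.1.2) := by
    fun_prop
  have input : TimeIn cost fun x : (ℕ × ℕ) × Raw => x := timeIn_cost PolyTime.id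
  have whole := TimeIn.comp this
    (input.prodMk (timeIn_levels.prodMk (timeIn_ranks.prodMk timeIn_vectors)))
  dsimp only at whole
  unfold solve
  exact whole

theorem exists_polynomial_cost_le (e : ℕ × ℕ) :
    ∃ q : Polynomial ℕ, ∀ I : Raw, cost (e, I) ≤ q.eval (bitSize I) := by
  generalize hr : accuracy e = r
  generalize hm : numRanks r = m
  refine ⟨Polynomial.X + Polynomial.C (bitSize e + 1) +
    (Polynomial.C (2 * m * r ^ 3) * (Polynomial.X + 1) + 2) ^ (m + 2), fun I => ?_⟩
  have := length_lt_bitSize I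
  simp only [cost, bitSize_pair, resolution, hr, hm, Polynomial.eval_C, Polynomial.eval_add,
    Polynomial.eval_mul, Polynomial.eval_X, Polynomial.eval_pow, Polynomial.eval_ofNat,
    Polynomial.eval_one]
  refine Nat.add_le_add (by omega) (Nat.pow_le_pow_left ?_ _)
  gcongr

end Scheme

theorem piSplitAt_symm_eq_update {ι : Type*} [DecidableEq ι] {Ω : ι → Type*} (j : ι)
    (k k' : Ω j) (t : (i : {i // i ≠ j}) → Ω i) :
    (Equiv.piSplitAt j Ω).symm (k', t) =
      Function.update ((Equiv.piSplitAt j Ω).symm (k, t)) j k' := by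
  funext i
  by_cases h : i = j
  · subst h
    simp [Equiv.piSplitAt]
  · simp [Equiv.piSplitAt, h]

section Expect

variable {ι : Type*} [Fintype ι] [DecidableEq ι] {Ω : ι → Type*} [∀ i, Fintype (Ω i)]

/-- The expectation of `f` under the product of the distributions with the point masses `w i`. -/
def expect (w : (i : ι) → Ω i → ℝ) (f : ((i : ι) → Ω i) → ℝ) : ℝ :=
  ∑ s, (∏ i, w i (s i)) * f s

variable {w : (i : ι) → Ω i → ℝ} {f g : ((i : ι) → Ω i) → ℝ}

theorem expect_mono (hw : ∀ i k, 0 ≤ w i k) (h : ∀ s, f s ≤ g s) : expect w f ≤ expect w g :=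
  Finset.sum_le_sum fun s _ => mul_le_mul_of_nonneg_left (h s)
    (Finset.prod_nonneg fun i _ => hw i _)

theorem expect_nonneg (hw : ∀ i k, 0 ≤ w i k) (h : ∀ s, 0 ≤ f s) : 0 ≤ expect w f :=
  Finset.sum_nonneg fun s _ => mul_nonneg (Finset.prod_nonneg fun i _ => hw i _) (h s)

theorem expect_add (f g : ((i : ι) → Ω i) → ℝ) :
    (expect w fun s => f s + g s) = expect w f + expect w g := by
  simp only [expect, mul_add, Finset.sum_add_distrib]

theorem expect_sub (f g : ((i : ι) → Ω i) → ℝ) :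
    (expect w fun s => f s - g s) = expect w f - expect w g := by
  simp only [expect, mul_sub, Finset.sum_sub_distrib]

theorem expect_mul_left (c : ℝ) (f : ((i : ι) → Ω i) → ℝ) :
    (expect w fun s => c * f s) = c * expect w f := by
  simp only [expect, Finset.mul_sum, mul_left_comm]

theorem expect_sum {κ : Type*} (t : Finset κ) (F : κ → ((i : ι) → Ω i) → ℝ) :
    (expect w fun s => ∑ j ∈ t, F j s) = ∑ j ∈ t, expect w (F j) := by
  simp only [expect, Finset.mul_sum]
  exact Finset.sum_comm

theorem expect_prod (φ : (i : ι) → Ω i → ℝ) :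
    (expect w fun s => ∏ i, φ i (s i)) = ∏ i, ∑ k, w i k * φ i k := by
  rw [Finset.prod_univ_sum, Fintype.piFinset_univ]
  exact Finset.sum_congr rfl fun s _ => Finset.prod_mul_distrib.symm

theorem expect_const (hw : ∀ i, ∑ k, w i k = 1) (c : ℝ) : (expect w fun _ => c) = c := by
  have one := expect_prod (w := w) fun _ _ => 1
  simp only [mul_one, hw, Finset.prod_const_one] at one
  simpa [one] using expect_mul_left (w := w) c fun _ => 1

theorem expect_eq_sum_sum (j : ι) (f : ((i : ι) → Ω i) → ℝ) :
    expect w f = ∑ k, ∑ t : ((i : {i // i ≠ j}) → Ω i),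
      w j k * (∏ i : {i // i ≠ j}, w i (t i)) * f ((Equiv.piSplitAt j Ω).symm (k, t)) := by
  rw [expect, ← Equiv.sum_comp (Equiv.piSplitAt j Ω).symm, Fintype.sum_prod_type]
  refine Finset.sum_congr rfl fun k _ => Finset.sum_congr rfl fun t _ => ?_
  rw [Fintype.prod_eq_mul_prod_subtype_ne _ j]
  congr 2
  · simp [Equiv.piSplitAt]
  · exact Finset.prod_congr rfl fun i _ => by simp [Equiv.piSplitAt, i.2]

theorem expect_mul_of_forall_update_eq (hw : ∀ i, ∑ k, w i k = 1) (j : ι) (φ : Ω j → ℝ)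
    (hf : ∀ s k, f (Function.update s j k) = f s) :
    (expect w fun s => φ (s j) * f s) = (∑ k, w j k * φ k) * expect w f := by
  have coord : ∀ k t, (Equiv.piSplitAt j Ω).symm (k, t) j = k := fun k t => by
    simp [Equiv.piSplitAt]
  simp only [expect_eq_sum_sum j, coord, Finset.sum_mul]
  refine Finset.sum_congr rfl fun k _ => ?_
  have rest : ∀ k' t, f ((Equiv.piSplitAt j Ω).symm (k', t)) =
      f ((Equiv.piSplitAt j Ω).symm (k, t)) := fun k' t => by
    rw [piSplitAt_symm_eq_update j k k' t, hf]
  simp only [rest, mul_assoc, ← Finset.mul_sum, ← Finset.sum_mul, hw, one_mul]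
  simp only [Finset.mul_sum]
  exact Finset.sum_congr rfl fun t _ => by ring

end Expect

namespace Instance

variable (I : Instance)

/-- The probabilities of the mass points as real numbers. -/
def mass (i : Fin I.n) (k : Fin (I.K i)) : ℝ := I.prob i k

/-- The values of the items in the profile `s` of mass points. -/
def values (s : (i : Fin I.n) → Fin (I.K i)) (i : Fin I.n) : ℝ := I.value i (s i)

theorem revenue_eq_expect (p : Fin I.n → ℝ) :
    I.revenue p = expect I.mass fun s => payment (I.values s) p := rfl

theorem mass_nonneg (i : Fin I.n) (k : Fin (I.K i)) : 0 ≤ I.mass i k :=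
  NNRat.cast_nonneg _

theorem sum_mass (i : Fin I.n) : ∑ k, I.mass i k = 1 := by
  have := I.prob_sum i
  unfold mass
  exact_mod_cast this

/-- The probability that the value of an item is at least `y`. -/
noncomputable def tail (i : Fin I.n) (y : ℝ) : ℝ :=
  ∑ k, I.mass i k * if y ≤ I.value i k then 1 else 0

theorem tail_nonneg (i : Fin I.n) (y : ℝ) : 0 ≤ I.tail i y :=
  Finset.sum_nonneg fun k _ => mul_nonneg (I.mass_nonneg i k) (by split_ifs <;> norm_num)

theorem tail_antitone (i : Fin I.n) : Antitone (I.tail i) := fun y z hyz =>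
  Finset.sum_le_sum fun k _ => mul_le_mul_of_nonneg_left
    (by split_ifs <;> first | (exfalso; linarith) | norm_num) (I.mass_nonneg i k)

variable {f : ((i : Fin I.n) → Fin (I.K i)) → ℝ}

theorem expect_tail_mul (j : Fin I.n) (y : ℝ) (hf : ∀ s k, f (Function.update s j k) = f s) :
    (expect I.mass fun s => (if y ≤ I.values s j then 1 else 0) * f s) =
      I.tail j y * expect I.mass f :=
  expect_mul_of_forall_update_eq I.sum_mass j (fun k => if y ≤ I.value j k then 1 else 0) hf

theorem expect_tail (j : Fin I.n) (y : ℝ) :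
    (expect I.mass fun s => if y ≤ I.values s j then 1 else 0) = I.tail j y := by
  simpa [expect_const I.sum_mass] using I.expect_tail_mul (f := fun _ => 1) j y fun _ _ => rfl

end Instance

section Payment

variable {n : ℕ} {v p : Fin n → ℝ}

theorem mem_favourites {i : Fin n} :
    i ∈ favourites v p ↔ 0 ≤ v i - p i ∧ ∀ j, v j - p j ≤ v i - p i := by
  simp [favourites]

theorem le_payment {i : Fin n} (h : i ∈ favourites v p) : p i ≤ payment v p := by
  rw [payment, dif_pos ⟨i, h⟩]
  exact Finset.le_sup' p h

theorem payment_eq_zero_or_mem (v p : Fin n → ℝ) :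
    (favourites v p = ∅ ∧ payment v p = 0) ∨ ∃ i ∈ favourites v p, payment v p = p i := by
  rcases (favourites v p).eq_empty_or_nonempty with empty | nonempty
  · exact .inl ⟨empty, by simp [payment, empty]⟩
  · obtain ⟨i, hi, sup_eq⟩ := Finset.exists_mem_eq_sup' nonempty p
    exact .inr ⟨i, hi, by rw [payment, dif_pos nonempty, sup_eq]⟩

theorem payment_nonneg (hp : ∀ i, 0 ≤ p i) : 0 ≤ payment v p := by
  rcases payment_eq_zero_or_mem v p with ⟨-, h⟩ | ⟨i, -, h⟩
  · exact h.ge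
  · exact h ▸ hp i

theorem favourites_nonempty {j : Fin n} (h : 0 ≤ v j - p j) : (favourites v p).Nonempty := by
  obtain ⟨i, -, hi⟩ :=
    Finset.exists_max_image Finset.univ (fun i => v i - p i) ⟨j, Finset.mem_univ j⟩
  exact ⟨i, mem_favourites.2
    ⟨h.trans (hi j (Finset.mem_univ _)), fun k => hi k (Finset.mem_univ _)⟩⟩

/-- The values of a buyer who is only interested in the items of `T`: the others are worth a
negative amount, so that they are not bought at nonnegative prices. -/
def only (T : Finset (Fin n)) (v : Fin n → ℝ) : Fin n → ℝ := fun i => if i ∈ T then v i else -1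

theorem mem_favourites_only {T : Finset (Fin n)} (hp : ∀ i, 0 ≤ p i) {i : Fin n} :
    i ∈ favourites (only T v) p ↔ i ∈ T ∧ 0 ≤ v i - p i ∧ ∀ j ∈ T, v j - p j ≤ v i - p i := by
  rw [mem_favourites]
  by_cases hi : i ∈ T
  · simp only [only, hi, if_true, true_and]
    refine and_congr_right fun _ => forall_congr' fun j => ?_
    by_cases hj : j ∈ T
    · simp [hj]
    · simp only [hj, if_false, false_imp_iff, iff_true]
      linarith [hp j]
  · simp only [only, hi, if_false, false_and, iff_false, not_and]
    intro
    linarith [hp i]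

theorem payment_le_add_only (T : Finset (Fin n)) (hp : ∀ i, 0 ≤ p i) :
    payment v p ≤ ∑ j ∈ Tᶜ, p j * (if p j ≤ v j then 1 else 0) + payment (only T v) p := by
  have separate : ∀ j ∈ Tᶜ, 0 ≤ p j * (if p j ≤ v j then 1 else 0 : ℝ) := fun j _ =>
    mul_nonneg (hp j) (by split_ifs <;> norm_num)
  have := Finset.sum_nonneg separate
  have := payment_nonneg (v := only T v) hp
  rcases payment_eq_zero_or_mem v p with ⟨-, h⟩ | ⟨i, hi, h⟩
  · linarith
  · rw [h]
    rw [mem_favourites] at hi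
    by_cases hT : i ∈ T
    · have := le_payment ((mem_favourites_only (v := v) hp).2 ⟨hT, hi.1, fun j _ => hi.2 j⟩)
      linarith
    · have term_le := Finset.single_le_sum separate (Finset.mem_compl.2 hT)
      rw [if_pos (by linarith [hi.1]), mul_one] at term_le
      linarith

theorem payment_only_le_payment {T : Finset (Fin n)} (hp : ∀ i, 0 ≤ p i)
    (hlow : ∀ j ∉ T, v j < p j) : payment (only T v) p ≤ payment v p := by
  rcases payment_eq_zero_or_mem (only T v) p with ⟨-, h⟩ | ⟨i, hi, h⟩
  · exact h ▸ payment_nonneg hp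
  · rw [mem_favourites_only hp] at hi
    refine h ▸ le_payment (mem_favourites.2 ⟨hi.2.1, fun j => ?_⟩)
    by_cases hj : j ∈ T
    · exact hi.2.2 j hj
    · linarith [hlow j hj, hi.2.1]

theorem add_only_le_payment (T : Finset (Fin n)) (hp : ∀ i, 0 ≤ p i) {t : ℝ} {y : Fin n → ℝ}
    (ht : 0 ≤ t) (hy : ∀ j ∈ Tᶜ, t + p j ≤ y j) (hpos : ∀ j ∈ Tᶜ, 0 < p j) :
    ∑ j ∈ Tᶜ, p j * (if y j ≤ v j ∧ ∀ i ≠ j, v i < t then 1 else 0) +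
      payment (only T v) p * (if ∀ j ∈ Tᶜ, v j < p j then 1 else 0) ≤ payment v p := by
  by_cases unique : ∃ j ∈ Tᶜ, y j ≤ v j ∧ ∀ i ≠ j, v i < t
  · obtain ⟨j, hj, large, others⟩ := unique
    have bought : ¬ ∀ j ∈ Tᶜ, v j < p j := fun h => by linarith [h j hj, hy j hj]
    rw [if_neg bought, mul_zero, add_zero, Finset.sum_eq_single_of_mem j hj,
      if_pos ⟨large, others⟩, mul_one]
    · refine le_payment (mem_favourites.2 ⟨by linarith [hy j hj], fun i => ?_⟩)
      rcases eq_or_ne i j with rfl | hij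
      · exact le_rfl
      · linarith [others i hij, hy j hj, hp i]
    · intro i hi hij
      rw [if_neg, mul_zero]
      rintro ⟨large_i, -⟩
      linarith [others i hij, hy i hi, hpos i hi]
  · rw [Finset.sum_eq_zero fun j hj => by rw [if_neg fun h => unique ⟨j, hj, h⟩, mul_zero],
      zero_add]
    split_ifs with low
    · rw [mul_one]
      exact payment_only_le_payment hp fun j hj => low j (Finset.mem_compl.2 hj)
    · rw [mul_zero]
      exact payment_nonneg hp

end Payment

theorem sum_mul_le_payment {n : ℕ} {v p : Fin n → ℝ} {H : ℝ} (hH : 0 ≤ H) (hp : ∀ i, H < p i) :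
    ∑ j, p j * ((if p j ≤ v j then 1 else 0) * (if ∀ i, i ≠ j → v i ≤ H then 1 else 0)) ≤
      payment v p := by
  by_cases unique : ∃ j, p j ≤ v j ∧ ∀ i, i ≠ j → v i ≤ H
  · obtain ⟨j, large, others⟩ := unique
    rw [Finset.sum_eq_single_of_mem j (Finset.mem_univ _), if_pos large, if_pos others, mul_one,
      mul_one]
    · refine le_payment (mem_favourites.2 ⟨by linarith, fun i => ?_⟩)
      rcases eq_or_ne i j with rfl | hij
      · exact le_rfl
      · linarith [others i hij, hp i]
    · intro i _ hij
      rw [if_neg, zero_mul, mul_zero]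
      linarith [others i hij, hp i]
  · refine (Finset.sum_eq_zero fun j _ => ?_).le.trans
      (payment_nonneg fun i => hH.trans (hp i).le)
    split_ifs with large others
    · exact absurd ⟨j, large, others⟩ unique
    all_goals simp

namespace Instance

variable {I : Instance}

theorem tail_eq_zero_or_exists (i : Fin I.n) (y : ℝ) :
    I.tail i y = 0 ∨ ∃ k, y ≤ I.value i k ∧ I.tail i y = I.tail i (I.value i k) := by
  by_cases h : ∃ k, y ≤ I.value i k
  · obtain ⟨k, hk, least⟩ := Finset.exists_min_image (Finset.univ.filter fun k => y ≤ I.value i k)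
      (fun k => (I.value i k : ℝ)) (by simpa [Finset.Nonempty] using h)
    simp only [Finset.mem_filter, Finset.mem_univ, true_and] at hk least
    refine .inr ⟨k, hk, Finset.sum_congr rfl fun l _ => ?_⟩
    congr 1
    exact if_congr ⟨least l, hk.trans⟩ rfl rfl
  · push Not at h
    exact .inl (Finset.sum_eq_zero fun k _ => by rw [if_neg (not_le.2 (h k)), mul_zero])

/-- `τ` is the best revenue from selling item `i` alone at a price above `H`; it is `0` if there is
no such price. -/
def IsTailRevenue (I : Instance) (i : Fin I.n) (H τ : ℝ) : Prop :=
  (∀ k, H < I.value i k → I.value i k * I.tail i (I.value i k) ≤ τ) ∧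
    (τ = 0 ∨ ∃ k, H < I.value i k ∧ τ = I.value i k * I.tail i (I.value i k))

theorem IsTailRevenue.nonneg {i : Fin I.n} {H τ : ℝ} (h : I.IsTailRevenue i H τ) : 0 ≤ τ := by
  rcases h.2 with h | ⟨k, -, h⟩
  · exact h.ge
  · exact h ▸ mul_nonneg (NNRat.cast_nonneg _) (I.tail_nonneg _ _)

theorem IsTailRevenue.mul_tail_le {i : Fin I.n} {H τ y : ℝ} (h : I.IsTailRevenue i H τ)
    (hy : H < y) : y * I.tail i y ≤ τ := by
  rcases tail_eq_zero_or_exists i y with zero | ⟨k, hk, eq⟩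
  · rw [zero, mul_zero]
    exact h.nonneg
  · rw [eq]
    exact (mul_le_mul_of_nonneg_right hk (I.tail_nonneg _ _)).trans (h.1 k (hy.trans_le hk))

theorem IsTailRevenue.exists_le_mul_tail {i : Fin I.n} {H τ : ℝ} (h : I.IsTailRevenue i H τ)
    (hH : 0 ≤ H) : ∃ y, H < y ∧ τ ≤ y * I.tail i y := by
  rcases h.2 with h | ⟨k, hk, h⟩
  · exact ⟨H + 1, by linarith, h.le.trans (mul_nonneg (by linarith) (I.tail_nonneg _ _))⟩
  · exact ⟨_, hk, h.le⟩

/-- `E` is a scale of the instance: it lies between the optimal revenue and four times the optimal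
revenue, and the tails of the values above `E` satisfy Markov's inequality in total. -/
structure IsScale (I : Instance) (E : ℝ) : Prop where
  mul_tail_le : ∀ y, E < y → y * ∑ i, I.tail i y ≤ E
  revenue_le : ∀ p : Fin I.n → ℝ, (∀ i, 0 ≤ p i) → I.revenue p ≤ E
  le_revenue : ∃ p : Fin I.n → ℝ, (∀ i, 0 ≤ p i) ∧ E ≤ 4 * I.revenue p

theorem revenue_nonneg {p : Fin I.n → ℝ} (hp : ∀ i, 0 ≤ p i) : 0 ≤ I.revenue p :=
  expect_nonneg I.mass_nonneg fun _ => payment_nonneg hp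

/-- The probability that some value exceeds `H`. -/
noncomputable def exceedProb (I : Instance) (H : ℝ) : ℝ :=
  expect I.mass fun s => if ∃ i, H < I.values s i then 1 else 0

theorem one_sub_exceedProb_le (H : ℝ) (j : Fin I.n) :
    1 - I.exceedProb H ≤
      expect I.mass fun s => if ∀ i, i ≠ j → I.values s i ≤ H then 1 else 0 := by
  rw [exceedProb]
  nth_rewrite 1 [← expect_const I.sum_mass 1]
  rw [← expect_sub]
  refine expect_mono I.mass_nonneg fun s => ?_
  by_cases exceeds : ∃ i, H < I.values s i
  · rw [if_pos exceeds, sub_self]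
    split_ifs <;> norm_num
  · rw [if_neg exceeds, sub_zero, if_pos]
    exact fun i _ => not_lt.1 fun h => exceeds ⟨i, h⟩

/- With probability at least one half no other value exceeds `H`, so that each item earns at least
half of what it would earn alone. -/
theorem exists_sum_le_two_mul_revenue {H : ℝ} (hH : 0 ≤ H) {τ : Fin I.n → ℝ}
    (hτ : ∀ i, I.IsTailRevenue i H (τ i)) (half : I.exceedProb H ≤ 1 / 2) :
    ∃ p : Fin I.n → ℝ, (∀ i, 0 ≤ p i) ∧ ∑ i, τ i ≤ 2 * I.revenue p := by
  choose p hp hτp using fun i => (hτ i).exists_le_mul_tail hH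
  have p_nonneg : ∀ i, 0 ≤ p i := fun i => hH.trans (hp i).le
  refine ⟨p, p_nonneg, ?_⟩
  have revenue_ge := expect_mono I.mass_nonneg fun s =>
    sum_mul_le_payment (v := I.values s) hH hp
  rw [← revenue_eq_expect, expect_sum] at revenue_ge
  refine le_trans ?_ (mul_le_mul_of_nonneg_left revenue_ge zero_le_two)
  rw [Finset.mul_sum]
  refine Finset.sum_le_sum fun j _ => ?_
  rw [expect_mul_left, expect_tail_mul (f := fun s =>
    if ∀ i, i ≠ j → I.values s i ≤ H then 1 else 0)]
  · have separate_nonneg := mul_nonneg (p_nonneg j) (I.tail_nonneg j (p j))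
    have others := I.one_sub_exceedProb_le H j
    nlinarith [hτp j, mul_le_mul_of_nonneg_left others separate_nonneg]
  · intro s k
    refine if_congr (forall_congr' fun i => forall_congr' fun hi => ?_) rfl rfl
    rw [values, values, Function.update_of_ne hi]

/-- `H` is `0` or one of the mass points. -/
def IsPoint (I : Instance) (H : ℝ) : Prop := H = 0 ∨ ∃ i k, H = I.value i k

theorem IsPoint.nonneg {H : ℝ} (h : I.IsPoint H) : 0 ≤ H := by
  rcases h with rfl | ⟨i, k, rfl⟩
  · rfl
  · exact NNRat.cast_nonneg _

theorem isPoint_values (s : (i : Fin I.n) → Fin (I.K i)) (i : Fin I.n) :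
    I.IsPoint (I.values s i) :=
  .inr ⟨i, s i, rfl⟩

theorem finite_setOf_isPoint (I : Instance) : {H | I.IsPoint H}.Finite := by
  refine ((Set.finite_singleton 0).union
    (Set.finite_range fun x : (i : Fin I.n) × Fin (I.K i) => (I.value x.1 x.2 : ℝ))).subset ?_
  rintro H (rfl | ⟨i, k, rfl⟩)
  · exact .inl rfl
  · exact .inr ⟨⟨i, k⟩, rfl⟩

theorem exists_minimal_exceedProb_le_half (I : Instance) :
    ∃ H, Minimal (fun H => I.IsPoint H ∧ I.exceedProb H ≤ 1 / 2) H := by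
  have finite := I.finite_setOf_isPoint
  obtain ⟨B, hB⟩ := finite.exists_maximal ⟨0, .inl rfl⟩
  refine (finite.subset fun H hH => hH.1).exists_minimal ⟨B, hB.1, ?_⟩
  have never : ∀ s : (i : Fin I.n) → Fin (I.K i),
      (if ∃ i, B < I.values s i then 1 else 0 : ℝ) = 0 := fun s =>
    if_neg fun ⟨i, hi⟩ => (hB.2 (I.isPoint_values s i) hi.le).not_gt hi
  simp only [exceedProb, never, expect_const I.sum_mass]
  norm_num

theorem mul_exceedProb_le_revenue {H L : ℝ} (hH : 0 ≤ H)
    (gap : ∀ x, I.IsPoint x → L < x → H ≤ x) :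
    H * I.exceedProb L ≤ I.revenue fun _ => H := by
  rw [exceedProb, ← expect_mul_left, revenue_eq_expect]
  refine expect_mono I.mass_nonneg fun s => ?_
  split_ifs with exceeds
  · obtain ⟨i, hi⟩ := exceeds
    obtain ⟨j, hj⟩ := favourites_nonempty (v := I.values s) (p := fun _ => H)
      (sub_nonneg.2 (gap _ (I.isPoint_values s i) hi))
    rw [mul_one]
    exact le_payment hj
  · rw [mul_zero]
    exact payment_nonneg fun _ => hH

theorem exists_median (I : Instance) : ∃ H : ℝ, I.IsPoint H ∧ I.exceedProb H ≤ 1 / 2 ∧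
    ∃ p : Fin I.n → ℝ, (∀ i, 0 ≤ p i) ∧ H ≤ 2 * I.revenue p := by
  obtain ⟨H, ⟨point, half⟩, least⟩ := I.exists_minimal_exceedProb_le_half
  refine ⟨H, point, half, fun _ => H, fun _ => point.nonneg, ?_⟩
  rcases point.nonneg.eq_or_lt with zero | pos
  · have := I.revenue_nonneg (p := fun _ => H) fun _ => point.nonneg
    linarith
  · obtain ⟨L, ⟨L_point, L_lt⟩, greatest⟩ := (I.finite_setOf_isPoint.subset
      fun L (hL : I.IsPoint L ∧ L < H) => hL.1).exists_maximal ⟨0, .inl rfl, pos⟩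
    have gap : ∀ x, I.IsPoint x → L < x → H ≤ x := fun x hx hLx =>
      not_lt.1 fun hxH => (greatest ⟨hx, hxH⟩ hLx.le).not_gt hLx
    have half_lt : 1 / 2 < I.exceedProb L :=
      not_le.1 fun h => (least ⟨L_point, h⟩ L_lt.le).not_gt L_lt
    nlinarith [mul_exceedProb_le_revenue pos.le gap]

theorem revenue_le_add_sum {H : ℝ} (hH : 0 ≤ H) {τ : Fin I.n → ℝ}
    (hτ : ∀ i, I.IsTailRevenue i H (τ i)) {p : Fin I.n → ℝ} (hp : ∀ i, 0 ≤ p i) :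
    I.revenue p ≤ H + ∑ i, τ i := by
  let T : Finset (Fin I.n) := Finset.univ.filter fun i => p i ≤ H
  have low_le : ∀ s, payment (only T (I.values s)) p ≤ H := fun s => by
    rcases payment_eq_zero_or_mem (only T (I.values s)) p with ⟨-, h⟩ | ⟨i, hi, h⟩
    · exact h ▸ hH
    · simpa [h, T] using ((mem_favourites_only hp).1 hi).1
  calc I.revenue p ≤ expect I.mass fun s =>
        ∑ j ∈ Tᶜ, p j * (if p j ≤ I.values s j then 1 else 0) + H :=
        expect_mono I.mass_nonneg fun s =>
          (payment_le_add_only T hp).trans (add_le_add_right (low_le s) _)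
    _ = H + ∑ j ∈ Tᶜ, p j * I.tail j (p j) := by
        simp only [expect_add, expect_const I.sum_mass, expect_sum, expect_mul_left, expect_tail,
          add_comm]
    _ ≤ H + ∑ j ∈ Tᶜ, τ j := by
        gcongr with j hj
        exact (hτ j).mul_tail_le (by simpa [T] using hj)
    _ ≤ H + ∑ j, τ j := by
        gcongr
        · exact fun i _ _ => (hτ i).nonneg
        · exact Finset.subset_univ _

theorem isScale_of_isLeast {τ : Fin I.n → ℝ → ℝ}
    (hτ : ∀ i, ∀ H, I.IsPoint H → I.IsTailRevenue i H (τ i H)) {E : ℝ}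
    (hE : IsLeast ((fun H => H + ∑ i, τ i H) '' {H | I.IsPoint H}) E) : I.IsScale E := by
  obtain ⟨⟨H, hH : I.IsPoint H, rfl⟩, least⟩ := hE
  have hτH := fun i => hτ i H hH
  have := Finset.sum_nonneg fun i (_ : i ∈ Finset.univ) => (hτH i).nonneg
  have := hH.nonneg
  refine ⟨fun y hy => ?_, fun p hp => revenue_le_add_sum hH.nonneg hτH hp, ?_⟩
  · have := Finset.sum_le_sum fun i (_ : i ∈ Finset.univ) =>
      (hτH i).mul_tail_le (show H < y by linarith)
    rw [← Finset.mul_sum] at this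
    linarith
  · obtain ⟨M, hM, half, p, hp, M_le⟩ := exists_median I
    obtain ⟨p', hp', sum_le⟩ := exists_sum_le_two_mul_revenue hM.nonneg (fun i => hτ i M hM) half
    have := least ⟨M, hM, rfl⟩
    dsimp only at this ⊢
    rcases le_total (I.revenue p) (I.revenue p') with h | h
    · exact ⟨p', hp', by linarith⟩
    · exact ⟨p, hp, by linarith⟩

end Instance

theorem levelRank_mod {C a c : ℕ} (hc : c ≤ C) (h : c ≤ a) : levelRank C a c % (C + 1) = c := by
  rw [levelRank, if_pos h, Nat.mul_add_mod_self_right, Nat.mod_eq_of_lt (by omega)]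

theorem levelRank_div {C a c : ℕ} (hc : c ≤ C) (h : c ≤ a) :
    levelRank C a c / (C + 1) = a - c := by
  rw [levelRank, if_pos h, mul_comm, Nat.mul_add_div (by omega), Nat.div_eq_of_lt (by omega),
    add_zero]

theorem levelRank_lt {C V a c : ℕ} (hc : c ≤ C) (ha : a ≤ V) :
    levelRank C a c < (V + 1) * (C + 1) := by
  rw [levelRank]
  split_ifs
  · have : (a - c) * (C + 1) ≤ V * (C + 1) := Nat.mul_le_mul (by omega) le_rfl
    rw [Nat.add_mul]
    omega
  · positivity

theorem le_of_levelRank_pos {C a c : ℕ} (h : 0 < levelRank C a c) : c ≤ a := by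
  by_contra hca
  simp [levelRank, hca] at h

theorem cast_sub_le_of_levelRank_le {C a b c d : ℕ} (hc : c ≤ C) (hd : d ≤ C) (hdb : d ≤ b)
    (h : levelRank C a c ≤ levelRank C b d) : (a : ℝ) - c ≤ b - d := by
  rcases le_or_gt c a with hca | hac
  · have := Nat.div_le_div_right (c := C + 1) h
    rw [levelRank_div hc hca, levelRank_div hd hdb] at this
    rw [← Nat.cast_sub hca, ← Nat.cast_sub hdb]
    exact_mod_cast this
  · have : (a : ℝ) < c := by exact_mod_cast hac
    have : (d : ℝ) ≤ b := by exact_mod_cast hdb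
    linarith

section Rounding

variable {r : ℝ}

theorem one_sub_inv_nonneg (hr : 1 ≤ r) : 0 ≤ 1 - 1 / r :=
  sub_nonneg.2 (div_le_one_of_le₀ hr (zero_le_one.trans hr))

theorem one_sub_inv_mul_le {x : ℝ} (hr : 1 ≤ r) (hx : 0 ≤ x) : (1 - 1 / r) * x ≤ x :=
  mul_le_of_le_one_left hx (sub_le_self_iff _ |>.2 (by positivity))

theorem one_sub_inv_mul_le_mul {x B : ℝ} (hr : 1 ≤ r) (hB : 0 ≤ B) (h : 1 / r * x ≤ B) :
    (1 - 1 / r) * x ≤ B * r := by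
  have r_pos := zero_lt_one.trans_le hr
  rw [one_div, inv_mul_eq_div, div_le_iff₀ r_pos] at h
  exact (mul_le_mul_of_nonneg_left h (one_sub_inv_nonneg hr)).trans
    (one_sub_inv_mul_le hr (by positivity))

variable {n : ℕ} {v p : Fin n → ℝ} {T : Finset (Fin n)} {a c : Fin n → ℕ} {g : ℝ} {C : ℕ}

/- An item `j` of rank at least that of a favourite item `i` is at most two units worse than `i` in
utility. Since rounded prices are discounted by the factor `1 - 1 / r`, a price difference counts
`1 / r` times against the buyer, and so it is at most `2 * g * r`. -/
theorem payment_only_le_levelRank (hg : 0 < g) (hr : 1 ≤ r) (hp : ∀ i, 0 ≤ p i)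
    (ha : ∀ i ∈ T, g * a i ≤ v i ∧ v i < g * (a i + 1))
    (hc : ∀ i ∈ T, g * c i ≤ (1 - 1 / r) * p i ∧ (1 - 1 / r) * p i < g * (c i + 1))
    (hC : ∀ i ∈ T, c i ≤ C) :
    (1 - 1 / r) * payment (only T v) p ≤
      g * ((T.sup fun i => levelRank C (a i) (c i)) % (C + 1) : ℕ) + 3 * g * r := by
  have g_le : g ≤ g * r := le_mul_of_one_le_right hg.le hr
  rcases payment_eq_zero_or_mem (only T v) p with ⟨-, h⟩ | ⟨i, hi, h⟩
  · rw [h, mul_zero]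
    positivity
  rw [h]
  obtain ⟨hiT, bought, best⟩ := (mem_favourites_only hp).1 hi
  have ⟨_, price_lt⟩ := hc i hiT
  have hci : c i ≤ a i := by
    have : g * c i < g * (a i + 1) := by linarith [one_sub_inv_mul_le hr (hp i), hc i hiT, ha i hiT]
    have := lt_of_mul_lt_mul_left this hg.le
    exact Nat.lt_succ_iff.1 (by exact_mod_cast this)
  obtain ⟨j, hj, sup_eq⟩ :=
    Finset.exists_mem_eq_sup T ⟨i, hiT⟩ fun i => levelRank C (a i) (c i)
  have rank_le : levelRank C (a i) (c i) ≤ levelRank C (a j) (c j) :=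
    sup_eq ▸ Finset.le_sup (f := fun i => levelRank C (a i) (c i)) hiT
  rcases Nat.eq_zero_or_pos (levelRank C (a j) (c j)) with zero | pos
  · have hci0 : c i = 0 := by
      rw [← levelRank_mod (hC i hiT) hci, Nat.le_zero.1 (rank_le.trans zero.le), Nat.zero_mod]
    have : 0 ≤ g * ((T.sup fun i => levelRank C (a i) (c i)) % (C + 1) : ℕ) := by positivity
    rw [hci0, Nat.cast_zero] at price_lt
    linarith
  · have hcj := le_of_levelRank_pos pos
    rw [sup_eq, levelRank_mod (hC j hj) hcj]
    have utility := mul_le_mul_of_nonneg_left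
      (cast_sub_le_of_levelRank_le (hC i hiT) (hC j hj) hcj rank_le) hg.le
    have : 1 / r * (p i - p j) ≤ 2 * g := by
      linarith [best j hj, hc i hiT, hc j hj, ha i hiT, ha j hj]
    linarith [one_sub_inv_mul_le_mul hr (by positivity) this, hc j hj]

theorem levelRank_le_payment_only (hg : 0 < g) (hr : 1 ≤ r) (hp : ∀ i, 0 ≤ p i)
    (ha : ∀ i ∈ T, g * a i ≤ v i ∧ v i < g * (a i + 1))
    (hc : ∀ i ∈ T, p i = (1 - 1 / r) * (g * c i)) (hC : ∀ i ∈ T, c i ≤ C) :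
    (1 - 1 / r) * (g * ((T.sup fun i => levelRank C (a i) (c i)) % (C + 1) : ℕ)) ≤
      payment (only T v) p + g * r := by
  rcases Nat.eq_zero_or_pos (T.sup fun i => levelRank C (a i) (c i)) with zero | pos
  · have := payment_nonneg (v := only T v) hp
    rw [zero, Nat.zero_mod, Nat.cast_zero, mul_zero, mul_zero]
    positivity
  obtain ⟨j, hj, sup_eq⟩ := Finset.exists_mem_eq_sup T
    (Finset.nonempty_iff_ne_empty.2 fun h => by simp [h] at pos) fun i => levelRank C (a i) (c i)
  have hcj := le_of_levelRank_pos (sup_eq ▸ pos)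
  rw [sup_eq, levelRank_mod (hC j hj) hcj]
  have j_bought : 0 ≤ only T v j - p j := by
    rw [only, if_pos hj, hc j hj]
    have : (c j : ℝ) ≤ a j := by exact_mod_cast hcj
    have := mul_le_mul_of_nonneg_left this hg.le
    linarith [ha j hj, one_sub_inv_mul_le hr (show 0 ≤ g * c j by positivity)]
  rcases payment_eq_zero_or_mem (only T v) p with ⟨h, -⟩ | ⟨i, hi, h⟩
  · exact absurd h (favourites_nonempty j_bought).ne_empty
  obtain ⟨hiT, -, best⟩ := (mem_favourites_only hp).1 hi
  have utility := mul_le_mul_of_nonneg_left (cast_sub_le_of_levelRank_le (hC i hiT) (hC j hj) hcj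
    (sup_eq ▸ Finset.le_sup (f := fun i => levelRank C (a i) (c i)) hiT)) hg.le
  have best_j := best j hj
  rw [hc i hiT, hc j hj] at best_j
  have : 1 / r * (g * c j - g * c i) ≤ g := by linarith [ha i hiT, ha j hj]
  rw [h, hc i hiT]
  linarith [one_sub_inv_mul_le_mul hr hg.le this]

end Rounding

theorem sum_indicator_nonneg {ι : Type*} (t : Finset ι) (v y : ι → ℝ) :
    0 ≤ ∑ i ∈ t, if y i ≤ v i then (1 : ℝ) else 0 :=
  Finset.sum_nonneg fun i _ => by split_ifs <;> norm_num

theorem one_le_sum_indicator {ι : Type*} {t : Finset ι} {v y : ι → ℝ} (h : ∃ i ∈ t, y i ≤ v i) :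
    1 ≤ ∑ i ∈ t, if y i ≤ v i then (1 : ℝ) else 0 := by
  obtain ⟨i, hi, hyi⟩ := h
  have := Finset.single_le_sum (f := fun i => if y i ≤ v i then (1 : ℝ) else 0)
    (fun i _ => by split_ifs <;> norm_num) hi
  simpa [hyi] using this

section Payment

variable {n : ℕ} {v p y : Fin n → ℝ} {T : Finset (Fin n)} {t : ℝ}

theorem sum_sub_add_sub_le_payment (hp : ∀ i, 0 ≤ p i) (ht : 0 ≤ t)
    (hy : ∀ j ∈ Tᶜ, t + p j ≤ y j) (hpos : ∀ j ∈ Tᶜ, 0 < p j) :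
    ∑ j ∈ Tᶜ, p j * ((if y j ≤ v j then 1 else 0) *
        (1 - ∑ i ∈ Finset.univ.erase j, if t ≤ v i then 1 else 0)) +
      (payment (only T v) p - ∑ j ∈ Tᶜ, (if p j ≤ v j then 1 else 0) * payment (only T v) p) ≤
      payment v p := by
  refine le_trans (add_le_add
    (Finset.sum_le_sum fun j _ => mul_le_mul_of_nonneg_left ?_ (hp j)) ?_)
    (add_only_le_payment T hp ht hy hpos)
  · by_cases large : y j ≤ v j
    · simp only [large, if_true, true_and, one_mul]
      split_ifs with others
      · rw [sub_le_self_iff]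
        exact sum_indicator_nonneg _ _ _
      · push Not at others
        obtain ⟨i, hi, hti⟩ := others
        have := one_le_sum_indicator (v := v) (y := fun _ => t)
          ⟨i, Finset.mem_erase.2 ⟨hi, Finset.mem_univ i⟩, hti⟩
        linarith
    · simp [large]
  · have pay_nonneg := payment_nonneg (v := only T v) hp
    rw [← Finset.sum_mul]
    split_ifs with low
    · rw [mul_one, sub_le_self_iff]
      exact mul_nonneg (sum_indicator_nonneg _ _ _) pay_nonneg
    · push Not at low
      have := le_mul_of_one_le_left pay_nonneg (one_le_sum_indicator low)
      linarith

end Payment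

/-- A bound for the revenue at prices below `r ^ 2 * E` that is lost or gained by disregarding
exceptional values, those that are at least `r ^ 3 * E`. -/
noncomputable def excess (E : ℝ) (r : ℕ) {n : ℕ} (v : Fin n → ℝ) : ℝ :=
  (r : ℝ) ^ 2 * E * ∑ i, if (r : ℝ) ^ 3 * E ≤ v i then 1 else 0

section Excess

variable {E : ℝ} {r n : ℕ} {v : Fin n → ℝ}

theorem excess_nonneg (hE : 0 ≤ E) : 0 ≤ excess E r v :=
  mul_nonneg (by positivity) (sum_indicator_nonneg _ _ _)

theorem le_excess (hE : 0 ≤ E) (h : ∃ i, (r : ℝ) ^ 3 * E ≤ v i) :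
    (r : ℝ) ^ 2 * E ≤ excess E r v := by
  obtain ⟨i, hi⟩ := h
  exact le_mul_of_one_le_right (by positivity)
    (one_le_sum_indicator ⟨i, Finset.mem_univ i, hi⟩)

end Excess

namespace Instance

variable {I : Instance} {E : ℝ} {r : ℕ} {a : (i : Fin I.n) → Fin (I.K i) → ℕ}

theorem IsScale.sum_tail_le (hE : I.IsScale E) (E_pos : 0 < E) {x : ℝ} (hx : 1 < x) :
    ∑ i, I.tail i (x * E) ≤ 1 / x := by
  have := hE.mul_tail_le (x * E) (by nlinarith)
  rw [le_div_iff₀ (by linarith)]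
  nlinarith

theorem IsScale.expect_excess_le (hE : I.IsScale E) (E_pos : 0 < E) (hr : 2 ≤ r) :
    (expect I.mass fun s => excess E r (I.values s)) ≤ E / r := by
  have : (2 : ℝ) ≤ r := by exact_mod_cast hr
  have : (1 : ℝ) < (r : ℝ) ^ 3 := one_lt_pow₀ (by linarith) (by norm_num)
  simp only [excess, expect_mul_left, expect_sum, expect_tail]
  refine (mul_le_mul_of_nonneg_left (hE.sum_tail_le E_pos this) (by positivity)).trans
    (le_of_eq ?_)
  field_simp

/-- The price level that the buyer pays in the rounded market of the items of `T`, where `a` gives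
the value levels of the mass points and `c` the price levels. -/
def levelPaid (I : Instance) (r : ℕ) (a : (i : Fin I.n) → Fin (I.K i) → ℕ)
    (T : Finset (Fin I.n)) (c : Fin I.n → ℕ) (s : (i : Fin I.n) → Fin (I.K i)) : ℕ :=
  (T.sup fun i => levelRank (r ^ 4) (a i (s i)) (c i)) % (r ^ 4 + 1)

theorem levelPaid_le (T : Finset (Fin I.n)) (c : Fin I.n → ℕ) (s : (i : Fin I.n) → Fin (I.K i)) :
    I.levelPaid r a T c s ≤ r ^ 4 :=
  Nat.lt_succ_iff.1 (Nat.mod_lt _ (Nat.succ_pos _))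

/-- The mean price level that the buyer pays in the rounded market of the items of `T`. -/
noncomputable def meanLevel (I : Instance) (r : ℕ) (a : (i : Fin I.n) → Fin (I.K i) → ℕ)
    (T : Finset (Fin I.n)) (c : Fin I.n → ℕ) : ℝ :=
  expect I.mass fun s => (I.levelPaid r a T c s : ℝ)

/-- `a` gives the value levels of all values that are not exceptional. -/
def IsLevel (I : Instance) (E : ℝ) (r : ℕ) (a : (i : Fin I.n) → Fin (I.K i) → ℕ) : Prop :=
  ∀ i k, (I.value i k : ℝ) < (r : ℝ) ^ 3 * E →
    E / (r : ℝ) ^ 2 * a i k ≤ I.value i k ∧ (I.value i k : ℝ) < E / (r : ℝ) ^ 2 * (a i k + 1)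

section Pointwise

variable {p : Fin I.n → ℝ} {T : Finset (Fin I.n)} {c : Fin I.n → ℕ}

theorem payment_only_le_levelPaid (E_pos : 0 < E) (hr : 1 ≤ r) (ha : I.IsLevel E r a)
    (hp : ∀ i, 0 ≤ p i) (hT : ∀ i ∈ T, p i < (r : ℝ) ^ 2 * E)
    (hc : ∀ i ∈ T, E / (r : ℝ) ^ 2 * c i ≤ (1 - 1 / r) * p i ∧
      (1 - 1 / r) * p i < E / (r : ℝ) ^ 2 * (c i + 1))
    (hC : ∀ i ∈ T, c i ≤ r ^ 4) (s : (i : Fin I.n) → Fin (I.K i)) :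
    (1 - 1 / r) * payment (only T (I.values s)) p ≤
      E / (r : ℝ) ^ 2 * I.levelPaid r a T c s +
        (3 * (E / (r : ℝ) ^ 2) * r + excess E r (I.values s)) := by
  have hr' : (1 : ℝ) ≤ r := by exact_mod_cast hr
  by_cases exceptional : ∃ i, (r : ℝ) ^ 3 * E ≤ I.values s i
  · have := le_excess E_pos.le exceptional
    have payment_le : payment (only T (I.values s)) p ≤ (r : ℝ) ^ 2 * E := by
      rcases payment_eq_zero_or_mem (only T (I.values s)) p with ⟨-, h⟩ | ⟨i, hi, h⟩
      · rw [h]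
        positivity
      · exact h ▸ (hT i ((mem_favourites_only hp).1 hi).1).le
    have := one_sub_inv_mul_le hr' (payment_nonneg (v := only T (I.values s)) hp)
    have : 0 ≤ E / (r : ℝ) ^ 2 * I.levelPaid r a T c s := by positivity
    have : 0 ≤ 3 * (E / (r : ℝ) ^ 2) * r := by positivity
    linarith
  · push Not at exceptional
    have := payment_only_le_levelRank (v := I.values s) (T := T) (a := fun i => a i (s i)) (c := c)
      (by positivity) hr' hp (fun i _ => ha i (s i) (exceptional i)) hc hC
    have := excess_nonneg (r := r) (v := I.values s) E_pos.le
    rw [levelPaid]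
    linarith

theorem levelPaid_le_payment_only (E_pos : 0 < E) (hr : 1 ≤ r) (ha : I.IsLevel E r a)
    (hp : ∀ i, 0 ≤ p i) (hC : ∀ i ∈ T, c i ≤ r ^ 4)
    (hc : ∀ i ∈ T, p i = (1 - 1 / r) * (E / (r : ℝ) ^ 2 * c i))
    (s : (i : Fin I.n) → Fin (I.K i)) :
    (1 - 1 / r) * (E / (r : ℝ) ^ 2 * I.levelPaid r a T c s) ≤
      payment (only T (I.values s)) p + (E / (r : ℝ) ^ 2 * r + excess E r (I.values s)) := by
  have hr' : (1 : ℝ) ≤ r := by exact_mod_cast hr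
  by_cases exceptional : ∃ i, (r : ℝ) ^ 3 * E ≤ I.values s i
  · have := le_excess E_pos.le exceptional
    have := payment_nonneg (v := only T (I.values s)) hp
    have : (I.levelPaid r a T c s : ℝ) ≤ (r : ℝ) ^ 4 := by exact_mod_cast levelPaid_le T c s
    have : E / (r : ℝ) ^ 2 * I.levelPaid r a T c s ≤ (r : ℝ) ^ 2 * E :=
      (mul_le_mul_of_nonneg_left this (by positivity)).trans_eq (by field_simp)
    have : 0 ≤ E / (r : ℝ) ^ 2 * r := by positivity
    refine (one_sub_inv_mul_le hr' (by positivity)).trans ?_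
    linarith
  · push Not at exceptional
    have := levelRank_le_payment_only (v := I.values s) (T := T) (a := fun i => a i (s i)) (c := c)
      (by positivity) hr' hp (fun i _ => ha i (s i) (exceptional i)) hc hC
    have := excess_nonneg (r := r) (v := I.values s) E_pos.le
    rw [levelPaid]
    linarith

end Pointwise

theorem revenue_le_estimate (hE : I.IsScale E) (E_pos : 0 < E) (hr : 2 ≤ r) (ha : I.IsLevel E r a)
    {p : Fin I.n → ℝ} (hp : ∀ i, 0 ≤ p i) {T : Finset (Fin I.n)} {c : Fin I.n → ℕ}
    (hT : ∀ i ∈ T, p i < (r : ℝ) ^ 2 * E)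
    (hc : ∀ i ∈ T, E / (r : ℝ) ^ 2 * c i ≤ (1 - 1 / r) * p i ∧
      (1 - 1 / r) * p i < E / (r : ℝ) ^ 2 * (c i + 1)) (hC : ∀ i ∈ T, c i ≤ r ^ 4) :
    (1 - 1 / r) * I.revenue p ≤ ∑ j ∈ Tᶜ, p j * I.tail j (p j) +
      E / (r : ℝ) ^ 2 * I.meanLevel r a T c + 4 * E / r := by
  have hr1 : (1 : ℝ) ≤ r := by exact_mod_cast one_le_two.trans hr
  have pointwise : ∀ s : (i : Fin I.n) → Fin (I.K i), (1 - 1 / r) * payment (I.values s) p ≤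
      ∑ j ∈ Tᶜ, p j * (if p j ≤ I.values s j then 1 else 0) +
      (E / (r : ℝ) ^ 2 * I.levelPaid r a T c s +
        (3 * (E / (r : ℝ) ^ 2) * r + excess E r (I.values s))) := fun s => by
    have split := mul_le_mul_of_nonneg_left
      (payment_le_add_only (v := I.values s) T hp) (one_sub_inv_nonneg hr1)
    have : 0 ≤ ∑ j ∈ Tᶜ, p j * (if p j ≤ I.values s j then 1 else 0) :=
      Finset.sum_nonneg fun j _ => mul_nonneg (hp j) (by split_ifs <;> norm_num)
    linarith [one_sub_inv_mul_le hr1 this,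
      payment_only_le_levelPaid E_pos (by omega) ha hp hT hc hC s]
  have mean := expect_mono I.mass_nonneg pointwise
  rw [expect_mul_left, ← revenue_eq_expect, expect_add, expect_add, expect_add, expect_mul_left,
    expect_const I.sum_mass, expect_sum] at mean
  simp only [expect_mul_left (p _), expect_tail] at mean
  have : 3 * (E / (r : ℝ) ^ 2) * r + E / r = 4 * E / r := by
    field_simp
    ring
  rw [meanLevel]
  linarith [hE.expect_excess_le E_pos hr]

theorem payment_only_update {n : ℕ} {K : Fin n → ℕ} (V : (i : Fin n) → Fin (K i) → ℝ)
    {p : Fin n → ℝ} {T : Finset (Fin n)} {j : Fin n} (hj : j ∉ T) (s : (i : Fin n) → Fin (K i))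
    (k : Fin (K j)) :
    payment (only T fun i => V i (Function.update s j k i)) p =
      payment (only T fun i => V i (s i)) p := by
  congr 1
  funext i
  by_cases hi : i ∈ T
  · simp only [only, Function.update_of_ne (ne_of_mem_of_not_mem hi hj)]
  · simp only [only, hi, if_false]

theorem add_mul_expect_payment_only_le_revenue {p y : Fin I.n → ℝ} {T : Finset (Fin I.n)} {t : ℝ}
    (hp : ∀ i, 0 ≤ p i) (ht : 0 ≤ t) (hy : ∀ j ∈ Tᶜ, t + p j ≤ y j) (hpos : ∀ j ∈ Tᶜ, 0 < p j) :
    ∑ j ∈ Tᶜ, p j * (I.tail j (y j) * (1 - ∑ i ∈ Finset.univ.erase j, I.tail i t)) +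
      (1 - ∑ j ∈ Tᶜ, I.tail j (p j)) * (expect I.mass fun s => payment (only T (I.values s)) p) ≤
      I.revenue p := by
  have mean := expect_mono I.mass_nonneg fun s =>
    sum_sub_add_sub_le_payment (v := I.values s) hp ht hy hpos
  rw [← revenue_eq_expect, expect_add, expect_sub, expect_sum, expect_sum] at mean
  refine le_trans (le_of_eq ?_) mean
  rw [sub_mul, one_mul, Finset.sum_mul]
  congr 1
  · refine Finset.sum_congr rfl fun j _ => ?_
    rw [expect_mul_left, expect_tail_mul (f := fun s =>
      1 - ∑ i ∈ Finset.univ.erase j, if t ≤ I.values s i then 1 else 0), expect_sub,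
      expect_const I.sum_mass, expect_sum]
    · simp only [expect_tail]
    · intro s k
      congr 1
      refine Finset.sum_congr rfl fun i hi => ?_
      rw [values, values, Function.update_of_ne (Finset.ne_of_mem_erase hi)]
  · congr 1
    refine Finset.sum_congr rfl fun j hj => ?_
    rw [expect_tail_mul (f := fun s => payment (only T (I.values s)) p)]
    exact payment_only_update (fun i k => (I.value i k : ℝ)) (Finset.mem_compl.1 hj)

theorem IsScale.mul_add_le_revenue (hE : I.IsScale E) (E_pos : 0 < E) (hr : 2 ≤ r)
    {p y : Fin I.n → ℝ} {T : Finset (Fin I.n)} (hp : ∀ i, 0 ≤ p i)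
    (hy : ∀ j ∈ Tᶜ, (r : ℝ) ^ 2 * E ≤ y j) (hpy : ∀ j ∈ Tᶜ, p j = (1 - 1 / r) * y j) :
    (1 - 1 / r) * (∑ j ∈ Tᶜ, p j * I.tail j (y j) +
      expect I.mass fun s => payment (only T (I.values s)) p) ≤ I.revenue p := by
  have hr2 : (2 : ℝ) ≤ r := by exact_mod_cast hr
  have gap : ∀ j ∈ Tᶜ, r * E + p j ≤ y j := fun j hj => by
    have : r * E ≤ 1 / r * y j := by
      rw [one_div, inv_mul_eq_div, le_div_iff₀ (by linarith)]
      nlinarith [hy j hj]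
    linarith [hpy j hj]
  have price_ge : ∀ j ∈ Tᶜ, r * E ≤ p j := fun j hj => by
    have expand : (1 - 1 / (r : ℝ)) * ((r : ℝ) ^ 2 * E) = (r - 1) * (r * E) := by field_simp
    have := mul_le_mul_of_nonneg_left (hy j hj) (one_sub_inv_nonneg (one_le_two.trans hr2))
    have : r * E ≤ (r - 1) * (r * E) := le_mul_of_one_le_left (by positivity) (by linarith)
    linarith [hpy j hj]
  have sum_tail_le : ∀ t : Finset (Fin I.n), ∑ i ∈ t, I.tail i (r * E) ≤ 1 / r := fun t =>
    (Finset.sum_le_sum_of_subset_of_nonneg (Finset.subset_univ _)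
      fun i _ _ => I.tail_nonneg i _).trans (hE.sum_tail_le E_pos (by linarith))
  refine le_trans ?_ (add_mul_expect_payment_only_le_revenue hp (by positivity) gap
    fun j hj => lt_of_lt_of_le (by positivity) (price_ge j hj))
  rw [mul_add, Finset.mul_sum]
  refine add_le_add (Finset.sum_le_sum fun j _ => ?_) (mul_le_mul_of_nonneg_right ?_
    (expect_nonneg I.mass_nonneg fun s => payment_nonneg hp))
  · rw [mul_comm, mul_assoc]
    have := sum_tail_le (Finset.univ.erase j)
    exact mul_le_mul_of_nonneg_left
      (mul_le_mul_of_nonneg_left (by linarith) (I.tail_nonneg j _)) (hp j)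
  · have := (Finset.sum_le_sum fun j hj => I.tail_antitone j (price_ge j hj)).trans
      (sum_tail_le Tᶜ)
    linarith

theorem IsScale.mul_meanLevel_le (hE : I.IsScale E) (E_pos : 0 < E) (hr : 2 ≤ r)
    (ha : I.IsLevel E r a) {p : Fin I.n → ℝ} {T : Finset (Fin I.n)} {c : Fin I.n → ℕ}
    (hp : ∀ i, 0 ≤ p i) (hC : ∀ i ∈ T, c i ≤ r ^ 4)
    (hc : ∀ i ∈ T, p i = (1 - 1 / r) * (E / (r : ℝ) ^ 2 * c i)) :
    (1 - 1 / r) * (E / (r : ℝ) ^ 2 * I.meanLevel r a T c) ≤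
      (expect I.mass fun s => payment (only T (I.values s)) p) + 2 * E / r := by
  have mean := expect_mono I.mass_nonneg
    (levelPaid_le_payment_only E_pos (one_le_two.trans hr) ha hp hC hc)
  rw [expect_mul_left, expect_mul_left, expect_add, expect_add, expect_const I.sum_mass] at mean
  have : E / (r : ℝ) ^ 2 * r + E / r = 2 * E / r := by
    field_simp
    ring
  rw [meanLevel]
  linarith [hE.expect_excess_le E_pos hr]

theorem estimate_le_revenue (hE : I.IsScale E) (E_pos : 0 < E) (hr : 2 ≤ r) (ha : I.IsLevel E r a)
    {p y : Fin I.n → ℝ} {T : Finset (Fin I.n)} {c : Fin I.n → ℕ} (hC : ∀ i ∈ T, c i ≤ r ^ 4)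
    (hc : ∀ i ∈ T, p i = (1 - 1 / r) * (E / (r : ℝ) ^ 2 * c i))
    (hy : ∀ i ∈ Tᶜ, (r : ℝ) ^ 2 * E ≤ y i) (hpy : ∀ i ∈ Tᶜ, p i = (1 - 1 / r) * y i) :
    (1 - 1 / r) ^ 2 * (∑ j ∈ Tᶜ, y j * I.tail j (y j) +
      E / (r : ℝ) ^ 2 * I.meanLevel r a T c) ≤ I.revenue p + 2 * E / r := by
  have hr1 : (1 : ℝ) ≤ r := by exact_mod_cast one_le_two.trans hr
  have factor_nonneg := one_sub_inv_nonneg hr1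
  have hp : ∀ i, 0 ≤ p i := fun i => by
    by_cases hi : i ∈ T
    · rw [hc i hi]
      positivity
    · rw [hpy i (Finset.mem_compl.2 hi)]
      have := hy i (Finset.mem_compl.2 hi)
      exact mul_nonneg factor_nonneg (le_trans (by positivity) this)
  have separate : ∑ j ∈ Tᶜ, p j * I.tail j (y j) =
      (1 - 1 / r) * ∑ j ∈ Tᶜ, y j * I.tail j (y j) := by
    rw [Finset.mul_sum]
    exact Finset.sum_congr rfl fun j hj => by rw [hpy j hj, mul_assoc]
  have split := hE.mul_add_le_revenue E_pos hr hp hy hpy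
  rw [separate] at split
  have := mul_le_mul_of_nonneg_left (hE.mul_meanLevel_le E_pos hr ha hp hC hc) factor_nonneg
  have := one_sub_inv_mul_le hr1 (show 0 ≤ 2 * E / r by positivity)
  linarith

end Instance

theorem sum_mul_indicator_le_sub_indicator_le_pred {m N : ℕ} (hN : N < m) {f : ℕ → ℝ}
    (hf : f 0 = 0) :
    ∑ k ∈ Finset.range m, f k * ((if N ≤ k then 1 else 0) - if N ≤ k - 1 then 1 else 0) = f N := by
  rw [Finset.sum_eq_single_of_mem N (Finset.mem_range.2 hN)]
  · rcases Nat.eq_zero_or_pos N with rfl | pos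
    · simp [hf]
    · rw [if_pos le_rfl, if_neg (by omega), sub_zero, mul_one]
  · intro k _ hk
    rcases Nat.eq_zero_or_pos k with rfl | pos
    · rw [hf, zero_mul]
    · rcases lt_or_gt_of_ne hk with lt | gt
      · rw [if_neg (by omega), if_neg (by omega), sub_self, mul_zero]
      · rw [if_pos (by omega), if_pos (by omega), sub_self, mul_zero]

theorem abs_cast_tsub_sub_le {x y : ℕ} {X Y N : ℝ} (hYX : Y ≤ X) (hx : (x : ℝ) ≤ X)
    (hX : X ≤ x + N) (hy : (y : ℝ) ≤ Y) (hY : Y ≤ y + N) :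
    |((x - y : ℕ) : ℝ) - (X - Y)| ≤ N := by
  rw [abs_le]
  rcases le_total y x with h | h
  · rw [Nat.cast_sub h]
    constructor <;> linarith
  · rw [Nat.sub_eq_zero_of_le h, Nat.cast_zero]
    have : (x : ℝ) ≤ y := by exact_mod_cast h
    constructor <;> linarith

namespace Instance

variable {I : Instance} {r : ℕ} {a : (i : Fin I.n) → Fin (I.K i) → ℕ} {T : Finset (Fin I.n)}
  {c : Fin I.n → ℕ}

/-- The probability that item `i` has rank at most `k`, where the items outside `T` have the least
rank by convention. -/
noncomputable def rankCdf (I : Instance) (r : ℕ) (a : (i : Fin I.n) → Fin (I.K i) → ℕ)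
    (T : Finset (Fin I.n)) (c : Fin I.n → ℕ) (i : Fin I.n) (k : ℕ) : ℝ :=
  ∑ l, I.mass i l * if i ∈ T → levelRank (r ^ 4) (a i l) (c i) ≤ k then 1 else 0

theorem prod_rankCdf (k : ℕ) : ∏ i, I.rankCdf r a T c i k = expect I.mass fun s =>
    if T.sup (fun i => levelRank (r ^ 4) (a i (s i)) (c i)) ≤ k then 1 else 0 := by
  simp only [rankCdf, Finset.sup_le_iff]
  rw [← expect_prod fun i l => if i ∈ T → levelRank (r ^ 4) (a i l) (c i) ≤ k then (1 : ℝ) else 0]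
  simp only [Finset.prod_boole, Finset.mem_univ, true_imp_iff]

theorem prod_rankCdf_mono : Monotone fun k => ∏ i, I.rankCdf r a T c i k := by
  intro k l hkl
  simp only [prod_rankCdf]
  refine expect_mono I.mass_nonneg fun s => ?_
  split_ifs with hk hl
  · rfl
  · exact absurd (hk.trans hkl) hl
  all_goals norm_num

theorem meanLevel_eq (hC : ∀ i ∈ T, c i ≤ r ^ 4) (ha : ∀ i k, a i k ≤ r ^ 5) :
    I.meanLevel r a T c = ∑ k ∈ Finset.range (Scheme.numRanks r), ((k % (r ^ 4 + 1) : ℕ) : ℝ) *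
      (∏ i, I.rankCdf r a T c i k - ∏ i, I.rankCdf r a T c i (k - 1)) := by
  simp only [prod_rankCdf, ← expect_sub, ← expect_mul_left, ← expect_sum]
  rw [meanLevel]
  congr 1
  funext s
  have rank_lt : (T.sup fun i => levelRank (r ^ 4) (a i (s i)) (c i)) < Scheme.numRanks r :=
    (Finset.sup_lt_iff (by simp [Scheme.numRanks])).2 fun i hi => levelRank_lt (hC i hi) (ha i _)
  exact (sum_mul_indicator_le_sub_indicator_le_pred rank_lt
    (f := fun k => ((k % (r ^ 4 + 1) : ℕ) : ℝ)) (by simp)).symm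

theorem abs_sum_sub_meanLevel_le (hC : ∀ i ∈ T, c i ≤ r ^ 4) (ha : ∀ i k, a i k ≤ r ^ 5)
    {s : ℕ → ℕ} {M N : ℝ} (hM : 0 ≤ M) (s_le : ∀ k, s k ≤ M * ∏ i, I.rankCdf r a T c i k)
    (le_s : ∀ k, M * ∏ i, I.rankCdf r a T c i k ≤ s k + N) :
    |((∑ k ∈ Finset.range (Scheme.numRanks r),
      k % (r ^ 4 + 1) * (s k - if k = 0 then 0 else s (k - 1)) : ℕ) : ℝ) -
      M * I.meanLevel r a T c| ≤ Scheme.numRanks r * ((r : ℝ) ^ 4 * N) := by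
  have hN : 0 ≤ N := by linarith [s_le 0, le_s 0]
  have term_le : ∀ k, |((k % (r ^ 4 + 1) * (s k - if k = 0 then 0 else s (k - 1)) : ℕ) : ℝ) -
      M * (((k % (r ^ 4 + 1) : ℕ) : ℝ) *
        (∏ i, I.rankCdf r a T c i k - ∏ i, I.rankCdf r a T c i (k - 1)))| ≤ (r : ℝ) ^ 4 * N := by
    intro k
    rcases Nat.eq_zero_or_pos k with rfl | hk
    · simp only [Nat.zero_mod, zero_mul, Nat.cast_zero, mul_zero, sub_self, abs_zero]
      positivity
    · rw [if_neg hk.ne', Nat.cast_mul, mul_left_comm, ← mul_sub, abs_mul, Nat.abs_cast, mul_sub M]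
      have mod_le : ((k % (r ^ 4 + 1) : ℕ) : ℝ) ≤ (r : ℝ) ^ 4 := by
        exact_mod_cast Nat.lt_succ_iff.1 (Nat.mod_lt k (Nat.succ_pos _))
      exact mul_le_mul mod_le (abs_cast_tsub_sub_le
        (mul_le_mul_of_nonneg_left (prod_rankCdf_mono (Nat.sub_le k 1)) hM) (s_le k) (le_s k)
        (s_le _) (le_s _)) (abs_nonneg _) (by positivity)
  rw [meanLevel_eq hC ha, Finset.mul_sum, Nat.cast_sum, ← Finset.sum_sub_distrib]
  refine (Finset.abs_sum_le_sum_abs _ _).trans ?_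
  simpa using Finset.sum_le_card_nsmul _ _ _ fun k (_ : k ∈ Finset.range (Scheme.numRanks r)) =>
    term_le k

end Instance

/-- The product of `M` and the fractions `F / D`, for `F` in a list, rounded down after every
factor. -/
def roundedProd (D M : ℕ) (l : List ℕ) : ℕ := l.foldr (fun F s => s * F / D) M

section RoundedProd

variable {D M : ℕ} {l : List ℕ}

theorem roundedProd_le : (roundedProd D M l : ℝ) ≤ M * (l.map fun F : ℕ => (F / D : ℝ)).prod := by
  induction l with
  | nil => simp [roundedProd]
  | cons F l ih =>
    rw [List.map_cons, List.prod_cons, mul_left_comm]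
    calc ((roundedProd D M l * F / D : ℕ) : ℝ) ≤ F / D * roundedProd D M l := by
          refine Nat.cast_div_le.trans_eq ?_
          push_cast
          ring
      _ ≤ _ := mul_le_mul_of_nonneg_left ih (by positivity)

theorem le_roundedProd_add_length (hD : 0 < D) (hl : ∀ F ∈ l, F ≤ D) :
    M * (l.map fun F : ℕ => (F / D : ℝ)).prod ≤ roundedProd D M l + l.length := by
  have hD' : (0 : ℝ) < D := by exact_mod_cast hD
  induction l with
  | nil => simp [roundedProd]
  | cons F l ih =>
    have F_le : (F : ℝ) / D ≤ 1 := by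
      rw [div_le_one hD']
      exact_mod_cast hl F List.mem_cons_self
    have floor : (F : ℝ) / D * roundedProd D M l ≤ (roundedProd D M l * F / D : ℕ) + 1 := by
      rw [div_mul_eq_mul_div, div_le_iff₀ hD', mul_comm _ (D : ℝ), mul_comm (F : ℝ)]
      exact_mod_cast (Nat.lt_mul_div_succ (roundedProd D M l * F) hD).le
    rw [List.map_cons, List.prod_cons, mul_left_comm]
    calc (F : ℝ) / D * (M * (l.map fun F : ℕ => (F / D : ℝ)).prod)
        ≤ F / D * (roundedProd D M l + l.length) :=
          mul_le_mul_of_nonneg_left (ih fun F h => hl F (List.mem_cons_of_mem _ h))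
            (by positivity)
      _ ≤ (roundedProd D M l * F / D : ℕ) + 1 + l.length := by
          rw [mul_add]
          exact add_le_add floor (mul_le_of_le_one_left (Nat.cast_nonneg _) F_le)
      _ = roundedProd D M (F :: l) + (F :: l).length := by
          rw [List.length_cons, Nat.cast_succ, add_right_comm, add_assoc]
          rfl

end RoundedProd

theorem forall₂_ofFn_right {α β : Type*} {R : α → β → Prop} {n : ℕ} {f : Fin n → β} {l : List α} :
    List.Forall₂ R l (List.ofFn f) ↔ ∃ g : Fin n → α, l = List.ofFn g ∧ ∀ i, R (g i) (f i) := by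
  rw [List.forall₂_iff_get]
  constructor
  · rintro ⟨length_eq, h⟩
    rw [List.length_ofFn] at length_eq
    subst length_eq
    exact ⟨l.get, (List.ofFn_get l).symm, fun i => by simpa using h i i.2 (by simp)⟩
  · rintro ⟨g, rfl, h⟩
    exact ⟨by simp, fun i _ hi => by simpa using h ⟨i, by simpa using hi⟩⟩

namespace Scheme

theorem distance_eq_zero {v w : List ℕ} (h : v.length = w.length) : distance v w = 0 ↔ v = w := by
  rw [← List.forall₂_eq_eq_eq, List.forall₂_iff_zip, distance, List.sum_eq_zero_iff]
  simp only [List.forall_mem_map, Prod.forall, h, true_and]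
  exact forall₃_congr fun x y _ => by omega

/-- The state that is reached by a sequence of choices without any pruning. -/
def path (D M : ℕ) (ranks : List ℕ) (xs : List Choice) : State :=
  xs.foldr (fun o e => extend D e o) (start M ranks)

section

variable {D M : ℕ} {ranks : List ℕ}

theorem path_bonus (xs : List Choice) : (path D M ranks xs).bonus = (xs.map Choice.bonus).sum := by
  induction xs with
  | nil => rfl
  | cons o xs ih => rw [List.map_cons, List.sum_cons, ← ih, add_comm]; rfl

theorem path_prices (xs : List Choice) : (path D M ranks xs).prices = xs.map Choice.price := by
  induction xs with
  | nil => rfl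
  | cons o xs ih => rw [List.map_cons, ← ih]; rfl

theorem path_cdf_ofFn {n : ℕ} {o : Fin n → Choice} {F : Fin n → ℕ → ℕ}
    (h : ∀ i, (o i).cdf = ranks.map (F i)) : (path D M ranks (List.ofFn o)).cdf =
      ranks.map fun k => roundedProd D M (List.ofFn fun i => F i k) := by
  induction n with
  | zero => simp [path, start, roundedProd]
  | succ n ih =>
    rw [List.ofFn_succ]
    change ((path D M ranks (List.ofFn fun i => o i.succ)).cdf.zip (o 0).cdf).map
      (fun y => y.1 * y.2 / D) = _
    rw [ih fun i => h i.succ, h 0, List.zip_map', List.map_map]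
    simp only [List.ofFn_succ]
    rfl

/-- The distribution function of the choice has the format that the dynamic program expects: one
weight out of `D` for each rank. -/
def IsProper (D : ℕ) (ranks : List ℕ) (o : Choice) : Prop :=
  o.cdf.length = ranks.length ∧ ∀ F ∈ o.cdf, F ≤ D

theorem length_path_cdf {xs : List Choice} (h : ∀ o ∈ xs, IsProper D ranks o) :
    (path D M ranks xs).cdf.length = ranks.length := by
  induction xs with
  | nil => simp [path, start]
  | cons o xs ih =>
    change (((path D M ranks xs).cdf.zip o.cdf).map fun y => y.1 * y.2 / D).length = _
    rw [List.length_map, List.length_zip, ih fun o ho => h o (List.mem_cons_of_mem _ ho),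
      (h o List.mem_cons_self).1, min_self]

theorem le_of_mem_path_cdf {xs : List Choice} (h : ∀ o ∈ xs, IsProper D ranks o) {s : ℕ}
    (hs : s ∈ (path D M ranks xs).cdf) : s ≤ M := by
  induction xs generalizing s with
  | nil =>
    obtain ⟨_, _, rfl⟩ := List.mem_map.1 hs
    exact le_rfl
  | cons o xs ih =>
    obtain ⟨⟨x, F⟩, hy, rfl⟩ := List.mem_map.1 hs
    have x_le := ih (fun o ho => h o (List.mem_cons_of_mem _ ho)) (List.of_mem_zip hy).1
    have F_le := (h o List.mem_cons_self).2 F (List.of_mem_zip hy).2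
    exact Nat.div_le_of_le_mul ((Nat.mul_le_mul x_le F_le).trans_eq (mul_comm M D))

theorem isProper_of_forall₂ {xs : List Choice} {L : List (List Choice)}
    (hL : ∀ opts ∈ L, ∀ o ∈ opts, IsProper D ranks o) (h : List.Forall₂ (· ∈ ·) xs L) :
    ∀ o ∈ xs, IsProper D ranks o := by
  induction h with
  | nil => exact fun _ ho => absurd ho List.not_mem_nil
  | cons ho _ ih =>
    rw [List.forall_mem_cons] at hL
    exact List.forall_mem_cons.2 ⟨hL.1 _ ho, ih hL.2⟩

theorem exists_path_of_mem_states {Z : List (List ℕ)} {L : List (List Choice)}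
    (hZ : ∀ z ∈ Z, z.length = ranks.length) (hL : ∀ opts ∈ L, ∀ o ∈ opts, IsProper D ranks o)
    {e : State} (he : e ∈ states D M ranks Z L) :
    ∃ xs, List.Forall₂ (· ∈ ·) xs L ∧ path D M ranks xs = e := by
  induction L generalizing e with
  | nil => exact ⟨[], .nil, (List.mem_singleton.1 he).symm⟩
  | cons opts L ih =>
    obtain ⟨hz, he⟩ := mem_round he
    obtain ⟨e', he', o, ho, close, eq⟩ := mem_extensions.1 he
    obtain ⟨xs, hxs, rfl⟩ := ih (fun o h => hL o (List.mem_cons_of_mem _ h)) he'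
    have chosen : List.Forall₂ (· ∈ ·) (o :: xs) (opts :: L) := .cons ho hxs
    have length_eq := length_path_cdf (M := M) (isProper_of_forall₂ hL chosen)
    refine ⟨o :: xs, chosen, ?_⟩
    rw [eq, ← (distance_eq_zero (length_eq.trans (hZ _ hz).symm)).1 close]
    rfl

theorem exists_mem_round {Z : List (List ℕ)} {opts : List Choice} {s : List State} {e : State}
    {o : Choice} (hZ : (extend D e o).cdf ∈ Z) (he : e ∈ s) (ho : o ∈ opts) :
    ∃ e' ∈ round D Z opts s, e'.cdf = (extend D e o).cdf ∧ e.bonus + o.bonus ≤ e'.bonus := by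
  have mem : extend D e o ∈ extensions D opts s (extend D e o).cdf :=
    mem_extensions.2 ⟨e, he, o, ho, (distance_eq_zero rfl).2 rfl, rfl⟩
  obtain ⟨b, hb⟩ := Option.ne_none_iff_exists'.1
    (List.argmax_eq_none (f := State.bonus).not.2 (List.ne_nil_of_mem mem))
  obtain ⟨_, _, _, _, _, eq⟩ := mem_extensions.1 (List.argmax_mem hb)
  exact ⟨b, List.mem_flatMap.2 ⟨_, hZ, Option.mem_toList.2 hb⟩, by rw [eq],
    List.le_of_mem_argmax mem hb⟩

theorem exists_mem_states {Z : List (List ℕ)} {L : List (List Choice)}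
    (hZ : ∀ z : List ℕ, z.length = ranks.length → (∀ s ∈ z, s ≤ M) → z ∈ Z)
    (hL : ∀ opts ∈ L, ∀ o ∈ opts, IsProper D ranks o) {xs : List Choice}
    (h : List.Forall₂ (· ∈ ·) xs L) :
    ∃ e ∈ states D M ranks Z L, e.cdf = (path D M ranks xs).cdf ∧
      (path D M ranks xs).bonus ≤ e.bonus := by
  induction h with
  | nil => exact ⟨start M ranks, List.mem_singleton.2 rfl, rfl, le_rfl⟩
  | @cons o opts xs L ho h ih =>
    obtain ⟨e, he, cdf_eq, bonus_le⟩ := ih fun o h => hL o (List.mem_cons_of_mem _ h)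
    have proper := isProper_of_forall₂ hL (.cons ho h)
    have extend_cdf : (extend D e o).cdf = (path D M ranks (o :: xs)).cdf := by
      simp only [extend, cdf_eq]
      rfl
    obtain ⟨e', he', cdf_eq', bonus_le'⟩ := exists_mem_round (extend_cdf ▸
      hZ _ (length_path_cdf proper) fun s => le_of_mem_path_cdf proper) he ho
    exact ⟨e', he', cdf_eq'.trans extend_cdf, le_trans (Nat.add_le_add_right bonus_le _) bonus_le'⟩

theorem exists_path_eq_argmax_states {r E : ℕ} {Z : List (List ℕ)} {L : List (List Choice)}
    (hZ : ∀ z : List ℕ, z ∈ Z ↔ z.length = ranks.length ∧ ∀ s ∈ z, s ≤ M)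
    (hL : ∀ opts ∈ L, ∀ o ∈ opts, IsProper D ranks o) (hne : ∃ xs, List.Forall₂ (· ∈ ·) xs L) :
    ∃ xs, List.Forall₂ (· ∈ ·) xs L ∧
      (states D M ranks Z L).argmax (merit r E D M ranks) = some (path D M ranks xs) ∧
      ∀ xs', List.Forall₂ (· ∈ ·) xs' L →
        merit r E D M ranks (path D M ranks xs') ≤ merit r E D M ranks (path D M ranks xs) := by
  have merit_le : ∀ xs', List.Forall₂ (· ∈ ·) xs' L → ∃ e ∈ states D M ranks Z L,
      merit r E D M ranks (path D M ranks xs') ≤ merit r E D M ranks e := by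
    intro xs' h
    obtain ⟨e, he, cdf_eq, bonus_le⟩ := exists_mem_states (fun z h h' => (hZ z).2 ⟨h, h'⟩) hL h
    refine ⟨e, he, ?_⟩
    rw [merit, merit, cdf_eq]
    gcongr
  have nonempty : states D M ranks Z L ≠ [] := by
    obtain ⟨xs, hxs⟩ := hne
    obtain ⟨e, he, -⟩ := merit_le xs hxs
    exact List.ne_nil_of_mem he
  obtain ⟨b, hb⟩ := Option.ne_none_iff_exists'.1
    (List.argmax_eq_none (f := merit r E D M ranks).not.2 nonempty)
  obtain ⟨xs, hxs, rfl⟩ :=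
    exists_path_of_mem_states (fun z hz => ((hZ z).1 hz).1) hL (List.argmax_mem hb)
  refine ⟨xs, hxs, hb, fun xs' h => ?_⟩
  obtain ⟨e, he, le⟩ := merit_le xs' h
  exact le.trans (List.le_of_mem_argmax he hb)

theorem meanLevel_map_range (r m : ℕ) (s : ℕ → ℕ) :
    meanLevel r (List.range m) ((List.range m).map s) =
      ∑ k ∈ Finset.range m, k % (r ^ 4 + 1) * (s k - if k = 0 then 0 else s (k - 1)) := by
  have zip_eq : (List.range m).zip (((List.range m).map s).zip (0 :: (List.range m).map s)) =
      (List.range m).map fun k => (k, (s k, if k = 0 then 0 else s (k - 1))) := by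
    refine List.ext_getElem (by simp) fun i _ _ => ?_
    rcases i with _ | i <;> simp
  rw [meanLevel, zip_eq, List.map_map]
  rfl

end

theorem le_tailRevenue {D H : ℕ} {item : Item} {x : ℕ × ℕ} (hx : x ∈ item) (hH : H < x.1) :
    x.1 * tailWeight item x.1 / D ≤ tailRevenue D H item := by
  refine List.le_max?_getD_of_mem (List.mem_map.2 ⟨x, hx, ?_⟩)
  rw [if_neg hH.not_ge]

theorem tailRevenue_eq_zero_or_exists (D H : ℕ) (item : Item) : tailRevenue D H item = 0 ∨
    ∃ x ∈ item, H < x.1 ∧ tailRevenue D H item = x.1 * tailWeight item x.1 / D := by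
  rw [tailRevenue]
  rcases h : (item.map fun x => if x.1 ≤ H then 0 else x.1 * tailWeight item x.1 / D).max? with
    _ | N
  · exact .inl (by rw [h, Option.getD_none])
  · obtain ⟨x, hx, rfl⟩ := List.mem_map.1 (List.max?_mem h)
    rw [h, Option.getD_some]
    split_ifs with hH
    · exact .inl rfl
    · exact .inr ⟨x, hx, not_le.1 hH, rfl⟩

theorem isLeast_scale (D : ℕ) (inst : List Item) :
    IsLeast ((fun H => H + (inst.map (tailRevenue D H)).sum) ''
      {H | H ∈ 0 :: inst.flatten.map Prod.fst}) (scale D inst) := by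
  rw [scale]
  rcases h : ((0 :: inst.flatten.map Prod.fst).map fun H =>
    H + (inst.map (tailRevenue D H)).sum).min? with _ | N
  · simp at h
  · obtain ⟨mem, least⟩ := List.min?_eq_some_iff.1 h
    refine ⟨List.mem_map.1 mem, ?_⟩
    rintro _ ⟨H, hH, rfl⟩
    exact least _ (List.mem_map.2 ⟨H, hH, rfl⟩)

end Scheme

namespace Instance

/-- The instance as a list over the items of their mass points, with numerators and denominators:
the input of the approximation scheme. -/
def raw (I : Instance) : Scheme.Raw :=
  List.ofFn fun i => List.ofFn fun k => (((I.value i k).num, (I.value i k).den),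
    ((I.prob i k).num, (I.prob i k).den))

theorem encode_eq (I : Instance) : I.encode = Enc.enc I.raw := by
  simp only [encode, raw, Enc.enc, List.map_ofFn, Function.comp_def]
  rfl

/-- A common denominator of all values and probabilities of the instance. -/
def denom (I : Instance) : ℕ := Scheme.denom I.raw

theorem mem_flatten_raw {I : Instance} {x : (ℕ × ℕ) × (ℕ × ℕ)} : x ∈ I.raw.flatten ↔
    ∃ i k, (((I.value i k).num, (I.value i k).den), ((I.prob i k).num, (I.prob i k).den)) = x := by
  simp only [raw, List.mem_flatten, List.mem_ofFn, ↓existsAndEq, true_and]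

variable {I : Instance}

theorem denom_dvd (i : Fin I.n) (k : Fin (I.K i)) :
    (I.value i k).den * (I.prob i k).den ∣ I.denom :=
  List.dvd_prod (List.mem_map.2 ⟨_, mem_flatten_raw.2 ⟨i, k, rfl⟩, rfl⟩)

theorem den_value_dvd (i : Fin I.n) (k : Fin (I.K i)) : (I.value i k).den ∣ I.denom :=
  (dvd_mul_right _ _).trans (denom_dvd i k)

theorem den_prob_dvd (i : Fin I.n) (k : Fin (I.K i)) : (I.prob i k).den ∣ I.denom :=
  (dvd_mul_left _ _).trans (denom_dvd i k)

theorem denom_pos (I : Instance) : 0 < I.denom := by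
  refine Nat.pos_of_ne_zero (List.prod_ne_zero fun zero_mem => ?_)
  obtain ⟨x, hx, zero⟩ := List.mem_map.1 zero_mem
  obtain ⟨i, k, rfl⟩ := mem_flatten_raw.1 hx
  exact (Nat.mul_pos (I.value i k).den_pos (I.prob i k).den_pos).ne' zero

theorem cast_denom_pos (I : Instance) : (0 : ℝ) < I.denom := by exact_mod_cast I.denom_pos

/-- The value of a mass point, in integral units. -/
def point (I : Instance) (i : Fin I.n) (k : Fin (I.K i)) : ℕ :=
  I.denom ^ 2 * (I.value i k).num / (I.value i k).den

/-- The probability of a mass point, in integral units. -/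
def weight (I : Instance) (i : Fin I.n) (k : Fin (I.K i)) : ℕ :=
  I.denom * (I.prob i k).num / (I.prob i k).den

/-- The mass points of an item, in integral units. -/
def item (I : Instance) (i : Fin I.n) : Scheme.Item :=
  List.ofFn fun k => (I.point i k, I.weight i k)

theorem integral_raw (I : Instance) : Scheme.integral I.raw = List.ofFn I.item := by
  unfold Scheme.integral
  generalize hD : Scheme.denom I.raw = D
  simp only [raw, List.map_ofFn]
  refine congrArg List.ofFn (funext fun i => ?_)
  simp only [Function.comp, item, point, weight, denom, hD, List.map_ofFn]
  rfl

theorem cast_point (i : Fin I.n) (k : Fin (I.K i)) :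
    (I.point i k : ℝ) = I.denom ^ 2 * I.value i k := by
  rw [point, Nat.cast_div ((dvd_pow (den_value_dvd i k) two_ne_zero).mul_right _)
    (by exact_mod_cast (I.value i k).den_ne_zero), NNRat.cast_def]
  push_cast
  ring

theorem cast_weight (i : Fin I.n) (k : Fin (I.K i)) :
    (I.weight i k : ℝ) = I.denom * I.mass i k := by
  rw [weight, Nat.cast_div ((den_prob_dvd i k).mul_right _)
    (by exact_mod_cast (I.prob i k).den_ne_zero), mass, NNRat.cast_def]
  push_cast
  ring

theorem denom_dvd_point (i : Fin I.n) (k : Fin (I.K i)) : I.denom ∣ I.point i k := by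
  obtain ⟨d, hd⟩ := den_value_dvd i k
  refine ⟨d * (I.value i k).num, Nat.div_eq_of_eq_mul_left (I.value i k).den_pos ?_⟩
  calc I.denom ^ 2 * (I.value i k).num
      = I.denom * ((I.value i k).den * d) * (I.value i k).num := by rw [← hd, sq]
    _ = _ := by ring

theorem point_div (i : Fin I.n) (k : Fin (I.K i)) :
    (I.point i k : ℝ) / I.denom ^ 2 = I.value i k := by
  rw [cast_point, mul_div_cancel_left₀ _ (pow_pos I.cast_denom_pos 2).ne']

theorem le_point_iff {y : ℕ} (i : Fin I.n) (k : Fin (I.K i)) :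
    y ≤ I.point i k ↔ (y : ℝ) / I.denom ^ 2 ≤ I.value i k := by
  rw [← point_div, div_le_div_iff_of_pos_right (pow_pos I.cast_denom_pos 2), Nat.cast_le]

theorem lt_point_iff {y : ℕ} (i : Fin I.n) (k : Fin (I.K i)) :
    y < I.point i k ↔ (y : ℝ) / I.denom ^ 2 < I.value i k := by
  rw [← point_div, div_lt_div_iff_of_pos_right (pow_pos I.cast_denom_pos 2), Nat.cast_lt]

theorem cast_sum_item (i : Fin I.n) (φ : ℕ → Prop) [DecidablePred φ] :
    (((I.item i).map fun x => if φ x.1 then x.2 else 0).sum : ℕ) =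
      (I.denom : ℝ) * ∑ k, I.mass i k * if φ (I.point i k) then 1 else 0 := by
  rw [item, List.map_ofFn, List.sum_ofFn, Nat.cast_sum, Finset.mul_sum]
  refine Finset.sum_congr rfl fun k _ => ?_
  simp only [Function.comp]
  split_ifs
  · rw [cast_weight, mul_one]
  · simp

theorem cast_tailWeight (i : Fin I.n) (y : ℕ) :
    (Scheme.tailWeight (I.item i) y : ℝ) = I.denom * I.tail i (y / I.denom ^ 2) := by
  simp only [tail, ← le_point_iff]
  exact cast_sum_item i fun x => y ≤ x

theorem cast_point_mul_tailWeight (i : Fin I.n) (k : Fin (I.K i)) :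
    ((I.point i k * Scheme.tailWeight (I.item i) (I.point i k) / I.denom : ℕ) : ℝ) / I.denom ^ 2 =
      I.value i k * I.tail i (I.value i k) := by
  have denom_pos := I.cast_denom_pos
  rw [Nat.cast_div ((denom_dvd_point i k).mul_right _) denom_pos.ne', Nat.cast_mul,
    cast_tailWeight, point_div, cast_point]
  field_simp

theorem isTailRevenue_tailRevenue (i : Fin I.n) (H : ℕ) :
    I.IsTailRevenue i (H / I.denom ^ 2)
      (Scheme.tailRevenue I.denom H (I.item i) / I.denom ^ 2) := by
  constructor
  · intro k hk
    have mem : (I.point i k, I.weight i k) ∈ I.item i := List.mem_ofFn.2 ⟨k, rfl⟩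
    rw [← cast_point_mul_tailWeight]
    gcongr
    exact Scheme.le_tailRevenue mem ((lt_point_iff i k).2 hk)
  · rcases Scheme.tailRevenue_eq_zero_or_exists I.denom H (I.item i) with zero | ⟨x, hx, lt, eq⟩
    · exact .inl (by rw [zero, Nat.cast_zero, zero_div])
    · obtain ⟨k, rfl⟩ := List.mem_ofFn.1 hx
      exact .inr ⟨k, (lt_point_iff i k).1 lt, by rw [eq, cast_point_mul_tailWeight]⟩

theorem setOf_isPoint (I : Instance) : {H | I.IsPoint H} =
    (fun N : ℕ => (N : ℝ) / I.denom ^ 2) ''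
      {N | N ∈ 0 :: (List.ofFn I.item).flatten.map Prod.fst} := by
  ext H
  simp [IsPoint, item, ← point_div, List.mem_ofFn, eq_comm]

theorem isScale_scale (I : Instance) :
    I.IsScale (Scheme.scale I.denom (List.ofFn I.item) / I.denom ^ 2) := by
  have unit_pos := pow_pos I.cast_denom_pos 2
  have floor (N : ℕ) : ⌊(N : ℝ) / I.denom ^ 2 * I.denom ^ 2⌋₊ = N := by
    rw [div_mul_cancel₀ _ unit_pos.ne', Nat.floor_natCast]
  refine isScale_of_isLeast (τ := fun i H =>
    Scheme.tailRevenue I.denom ⌊H * I.denom ^ 2⌋₊ (I.item i) / I.denom ^ 2) ?_ ?_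
  · intro i H hH
    obtain ⟨N, -, rfl⟩ := I.setOf_isPoint.subset hH
    simp only [floor]
    exact isTailRevenue_tailRevenue i N
  · have mono : Monotone fun N : ℕ => (N : ℝ) / I.denom ^ 2 := fun N M h => by
      simp only
      gcongr
    have image := mono.map_isLeast (Scheme.isLeast_scale I.denom (List.ofFn I.item))
    rw [Set.image_image] at image
    rw [setOf_isPoint, Set.image_image]
    simpa only [floor, List.map_ofFn, List.sum_ofFn, Nat.cast_add, Nat.cast_sum, add_div,
      Finset.sum_div, Function.comp] using image

/-- The value levels that the algorithm uses. -/
def levels (I : Instance) (r E : ℕ) (i : Fin I.n) (k : Fin (I.K i)) : ℕ :=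
  Scheme.level r E (I.point i k)

theorem isLevel_levels {r E : ℕ} (hr : 0 < r) (hE : 0 < E) :
    I.IsLevel (E / I.denom ^ 2) r (I.levels r E) := by
  intro i k hk
  have denom_pos := I.cast_denom_pos
  have r_pos : (0 : ℝ) < r := by exact_mod_cast hr
  have E_pos : (0 : ℝ) < E := by exact_mod_cast hE
  have point_lt : I.point i k < r ^ 3 * E := by
    rw [← point_div, ← mul_div_assoc, div_lt_div_iff_of_pos_right (by positivity)] at hk
    exact_mod_cast hk
  have level_lt : I.point i k * r ^ 2 / E < r ^ 5 := by
    rw [Nat.div_lt_iff_lt_mul hE]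
    calc I.point i k * r ^ 2 < r ^ 3 * E * r ^ 2 :=
          Nat.mul_lt_mul_of_pos_right point_lt (by positivity)
      _ = r ^ 5 * E := by ring
  rw [levels, Scheme.level, min_eq_left level_lt.le]
  set a := I.point i k * r ^ 2 / E
  have le_point : (a : ℝ) * E ≤ I.point i k * (r : ℝ) ^ 2 := by
    exact_mod_cast Nat.div_mul_le_self (I.point i k * r ^ 2) E
  have point_lt : I.point i k * (r : ℝ) ^ 2 < E * ((a : ℝ) + 1) := by
    exact_mod_cast Nat.lt_mul_div_succ (I.point i k * r ^ 2) hE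
  rw [cast_point] at le_point point_lt
  constructor
  · rw [div_div, div_mul_eq_mul_div, div_le_iff₀ (by positivity)]
    linarith
  · rw [div_div, div_mul_eq_mul_div, lt_div_iff₀ (by positivity)]
    linarith

theorem cast_rankWeight (r E : ℕ) (i : Fin I.n) (c k : ℕ) :
    (Scheme.rankWeight r E (I.item i) c k : ℝ) = I.denom *
      ∑ l, I.mass i l * if levelRank (r ^ 4) (I.levels r E i l) c ≤ k then 1 else 0 :=
  cast_sum_item i fun x => Scheme.rank r E x c ≤ k

end Instance

namespace Scheme

theorem resolution_pos {r : ℕ} (hr : 0 < r) (n : ℕ) : 0 < resolution r n := by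
  unfold resolution numRanks
  positivity

theorem numRanks_mul_le (r n : ℕ) : numRanks r * (r ^ 4 * n) ≤ r * resolution r n := by
  rw [resolution]
  calc numRanks r * (r ^ 4 * n) ≤ numRanks r * (r ^ 4 * (2 * (n + 1))) := by
        gcongr
        omega
    _ = r * (2 * numRanks r * r ^ 3 * (n + 1)) := by ring

end Scheme

namespace Instance

/-- The choice of the algorithm that puts item `i` at the price level `c`. -/
def lowOption (I : Instance) (r E : ℕ) (i : Fin I.n) (c : ℕ) : Scheme.Choice :=
  Scheme.lowChoice r E I.denom (List.range (Scheme.numRanks r)) (I.item i) c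

/-- The choice of the algorithm that puts item `i` at the high price `x`. -/
def highOption (I : Instance) (r E : ℕ) (i : Fin I.n) (x : ℕ) : Scheme.Choice :=
  Scheme.highChoice r E I.denom (List.range (Scheme.numRanks r)) (I.item i) x

/-- The choices of the algorithm for item `i`. -/
def options (I : Instance) (r E : ℕ) (i : Fin I.n) : List Scheme.Choice :=
  Scheme.choices r E I.denom (List.range (r ^ 4 + 1)) (List.range (Scheme.numRanks r)) (I.item i)

/-- The choices of the algorithm that put the items of `T` at the price levels `c` and the other
items at the high prices `x`. -/
def plan (I : Instance) (r E : ℕ) (T : Finset (Fin I.n)) (c x : Fin I.n → ℕ) (i : Fin I.n) :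
    Scheme.Choice :=
  if i ∈ T then I.lowOption r E i (c i) else I.highOption r E i (x i)

variable {I : Instance} {r E : ℕ} {T : Finset (Fin I.n)} {c x : Fin I.n → ℕ}

theorem mem_options {i : Fin I.n} {o : Scheme.Choice} : o ∈ I.options r E i ↔
    (∃ c ≤ r ^ 4, o = I.lowOption r E i c) ∨ ∃ k, o = I.highOption r E i (I.point i k) := by
  simp only [options, Scheme.choices, List.mem_append, List.mem_map, List.mem_range,
    Nat.lt_succ_iff, item, List.mem_ofFn, lowOption, highOption, ↓existsAndEq, true_and,
    eq_comm (a := o)]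

theorem plan_mem_options (hc : ∀ i ∈ T, c i ≤ r ^ 4) (hx : ∀ i ∉ T, ∃ k, x i = I.point i k)
    (i : Fin I.n) : I.plan r E T c x i ∈ I.options r E i := by
  rw [mem_options, plan]
  split_ifs with hi
  · exact .inl ⟨c i, hc i hi, rfl⟩
  · obtain ⟨k, hk⟩ := hx i hi
    exact .inr ⟨k, by rw [hk]⟩

theorem exists_eq_plan {o : Fin I.n → Scheme.Choice} (ho : ∀ i, o i ∈ I.options r E i) :
    ∃ (T : Finset (Fin I.n)) (c x : Fin I.n → ℕ), (∀ i ∈ T, c i ≤ r ^ 4) ∧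
      o = I.plan r E T c x := by
  classical
  let IsLow (i : Fin I.n) : Prop := ∃ c ≤ r ^ 4, o i = I.lowOption r E i c
  choose! c hc ho_low using fun i (h : IsLow i) => h
  choose! x ho_high using fun i (h : ¬ IsLow i) =>
    (show ∃ x, o i = I.highOption r E i x from
      let ⟨k, hk⟩ := (mem_options.1 (ho i)).resolve_left h
      ⟨_, hk⟩)
  refine ⟨Finset.univ.filter IsLow, c, x, fun i hi => hc i (Finset.mem_filter.1 hi).2,
    funext fun i => ?_⟩
  rw [plan]
  split_ifs with hi
  · exact ho_low i (Finset.mem_filter.1 hi).2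
  · exact ho_high i fun h => hi (Finset.mem_filter.2 ⟨Finset.mem_univ i, h⟩)

theorem rankWeight_le (i : Fin I.n) (c k : ℕ) :
    Scheme.rankWeight r E (I.item i) c k ≤ I.denom := by
  have mass_le : ∑ l, I.mass i l * (if levelRank (r ^ 4) (I.levels r E i l) c ≤ k then 1 else 0) ≤
      1 :=
    (Finset.sum_le_sum fun l _ => mul_le_of_le_one_right (I.mass_nonneg i l)
      (by split_ifs <;> norm_num)).trans_eq (I.sum_mass i)
  have : (Scheme.rankWeight r E (I.item i) c k : ℝ) ≤ I.denom := by
    rw [cast_rankWeight]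
    exact mul_le_of_le_one_right (Nat.cast_nonneg _) mass_le
  exact_mod_cast this

theorem isProper_of_mem_options {i : Fin I.n} {o : Scheme.Choice} (ho : o ∈ I.options r E i) :
    Scheme.IsProper I.denom (List.range (Scheme.numRanks r)) o := by
  rcases mem_options.1 ho with ⟨c, -, rfl⟩ | ⟨k, rfl⟩
  · refine ⟨List.length_map _, fun F hF => ?_⟩
    obtain ⟨k, -, rfl⟩ := List.mem_map.1 hF
    exact rankWeight_le i c k
  · refine ⟨List.length_map _, fun F hF => ?_⟩
    obtain ⟨_, -, rfl⟩ := List.mem_map.1 hF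
    exact le_rfl

theorem price_snd_pos_of_mem_options (hr : 0 < r) {i : Fin I.n} {o : Scheme.Choice}
    (ho : o ∈ I.options r E i) : 0 < o.price.2 := by
  have := I.denom_pos
  rcases mem_options.1 ho with ⟨c, -, rfl⟩ | ⟨k, rfl⟩
  · simp only [lowOption, Scheme.lowChoice]
    positivity
  · simp only [highOption, Scheme.highChoice]
    positivity

/-- The distribution function of the rank of item `i` in a plan, in integral units. -/
def planWeight (I : Instance) (r E : ℕ) (T : Finset (Fin I.n)) (c : Fin I.n → ℕ) (i : Fin I.n)
    (k : ℕ) : ℕ :=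
  if i ∈ T then Scheme.rankWeight r E (I.item i) (c i) k else I.denom

theorem plan_cdf (i : Fin I.n) : (I.plan r E T c x i).cdf =
    (List.range (Scheme.numRanks r)).map (I.planWeight r E T c i) := by
  unfold plan planWeight
  by_cases hi : i ∈ T
  · simp only [if_pos hi]
    rfl
  · simp only [if_neg hi]
    rfl

theorem planWeight_le (i : Fin I.n) (k : ℕ) : I.planWeight r E T c i k ≤ I.denom := by
  rw [planWeight]
  split_ifs
  · exact rankWeight_le i _ k
  · exact le_rfl

theorem planWeight_div_denom (i : Fin I.n) (k : ℕ) :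
    (I.planWeight r E T c i k : ℝ) / I.denom = I.rankCdf r (I.levels r E) T c i k := by
  rw [div_eq_iff I.cast_denom_pos.ne', mul_comm, planWeight, rankCdf]
  by_cases hi : i ∈ T
  · simp only [hi, if_true, true_imp_iff, cast_rankWeight]
  · simp only [hi, if_false, false_imp_iff, if_true, mul_one, sum_mass]

theorem prod_map_planWeight (k : ℕ) :
    ((List.ofFn fun i => I.planWeight r E T c i k).map fun F : ℕ => (F / I.denom : ℝ)).prod =
      ∏ i, I.rankCdf r (I.levels r E) T c i k := by
  rw [List.map_ofFn, List.prod_ofFn]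
  exact Finset.prod_congr rfl fun i _ => planWeight_div_denom i k

/-- The state of the dynamic program after the choices `o`, without pruning. -/
def finalState (I : Instance) (r : ℕ) (o : Fin I.n → Scheme.Choice) : Scheme.State :=
  Scheme.path I.denom (Scheme.resolution r I.n) (List.range (Scheme.numRanks r)) (List.ofFn o)

theorem abs_meanLevel_finalState_sub_le (hc : ∀ i ∈ T, c i ≤ r ^ 4) :
    |(Scheme.meanLevel r (List.range (Scheme.numRanks r))
        (I.finalState r (I.plan r E T c x)).cdf : ℝ) -
      Scheme.resolution r I.n * I.meanLevel r (I.levels r E) T c| ≤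
      r * Scheme.resolution r I.n := by
  rw [finalState, Scheme.path_cdf_ofFn plan_cdf, Scheme.meanLevel_map_range]
  refine (abs_sum_sub_meanLevel_le (a := I.levels r E) hc (fun i k => min_le_right _ _)
    (Nat.cast_nonneg _) (N := I.n) (fun k => ?_) fun k => ?_).trans ?_
  · rw [← prod_map_planWeight]
    exact roundedProd_le
  · rw [← prod_map_planWeight]
    refine (le_roundedProd_add_length I.denom_pos fun F hF => ?_).trans_eq
      (by rw [List.length_ofFn])
    obtain ⟨i, rfl⟩ := List.mem_ofFn.1 hF
    exact planWeight_le i k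
  · exact_mod_cast Scheme.numRanks_mul_le r I.n

/-- The price, before the final reduction, of an item at the high price `x`. -/
noncomputable def highPrice (I : Instance) (r E x : ℕ) : ℝ :=
  ((max x (r ^ 2 * E) : ℕ) : ℝ) / I.denom ^ 2

theorem le_highPrice (x : ℕ) :
    (r : ℝ) ^ 2 * (E / I.denom ^ 2) ≤ I.highPrice r E x := by
  rw [highPrice, ← mul_div_assoc]
  gcongr
  exact_mod_cast le_max_right x (r ^ 2 * E)

theorem bonus_plan (i : Fin I.n) : ((I.plan r E T c x i).bonus : ℝ) = if i ∈ T then 0 else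
    (I.denom : ℝ) ^ 3 * (I.highPrice r E (x i) * I.tail i (I.highPrice r E (x i))) := by
  rw [plan]
  split_ifs
  · exact Nat.cast_zero
  · have denom_pos := I.cast_denom_pos
    rw [highOption, Scheme.highChoice, Nat.cast_mul, cast_tailWeight, ← highPrice, highPrice]
    field_simp

theorem cast_bonus_finalState : ((I.finalState r (I.plan r E T c x)).bonus : ℝ) =
    (I.denom : ℝ) ^ 3 *
      ∑ j ∈ Tᶜ, I.highPrice r E (x j) * I.tail j (I.highPrice r E (x j)) := by
  rw [finalState, Scheme.path_bonus, List.map_ofFn, List.sum_ofFn, Nat.cast_sum]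
  simp only [Function.comp, bonus_plan, Finset.sum_ite, Finset.sum_const_zero, zero_add]
  rw [Finset.mul_sum]
  exact Finset.sum_congr (by ext; simp) fun _ _ => rfl

/-- The estimate of the revenue of a plan: the high prices are charged independently of all other
items, and the price level of the item of largest rank is paid besides. -/
noncomputable def estimate (I : Instance) (r E : ℕ) (T : Finset (Fin I.n)) (c x : Fin I.n → ℕ) :
    ℝ :=
  ∑ j ∈ Tᶜ, I.highPrice r E (x j) * I.tail j (I.highPrice r E (x j)) +
    E / I.denom ^ 2 / (r : ℝ) ^ 2 * I.meanLevel r (I.levels r E) T c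

/-- The merit of a sequence of choices, in the units of the revenue. -/
noncomputable def normalizedMerit (I : Instance) (r E : ℕ) (o : Fin I.n → Scheme.Choice) : ℝ :=
  (Scheme.merit r E I.denom (Scheme.resolution r I.n) (List.range (Scheme.numRanks r))
    (I.finalState r o) : ℝ) / ((I.denom : ℝ) ^ 3 * (r : ℝ) ^ 2 * Scheme.resolution r I.n)

theorem normalizedMerit_sub_estimate (hr : 0 < r) :
    I.normalizedMerit r E (I.plan r E T c x) - I.estimate r E T c x =
      E / I.denom ^ 2 / (r : ℝ) ^ 2 / Scheme.resolution r I.n *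
        (Scheme.meanLevel r (List.range (Scheme.numRanks r))
          (I.finalState r (I.plan r E T c x)).cdf -
        Scheme.resolution r I.n * I.meanLevel r (I.levels r E) T c) := by
  have := I.cast_denom_pos
  have : (0 : ℝ) < r := by exact_mod_cast hr
  have : (0 : ℝ) < Scheme.resolution r I.n := by
    exact_mod_cast Scheme.resolution_pos hr I.n
  rw [normalizedMerit, Scheme.merit, estimate]
  push_cast
  rw [cast_bonus_finalState]
  field_simp
  ring

theorem abs_normalizedMerit_sub_estimate_le (hr : 0 < r) (hc : ∀ i ∈ T, c i ≤ r ^ 4) :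
    |I.normalizedMerit r E (I.plan r E T c x) - I.estimate r E T c x| ≤ E / I.denom ^ 2 / r := by
  have := I.cast_denom_pos
  have : (0 : ℝ) < r := by exact_mod_cast hr
  have : (0 : ℝ) < Scheme.resolution r I.n := by
    exact_mod_cast Scheme.resolution_pos hr I.n
  have factor_nonneg : 0 ≤ E / I.denom ^ 2 / (r : ℝ) ^ 2 / Scheme.resolution r I.n := by
    positivity
  rw [normalizedMerit_sub_estimate hr, abs_mul, abs_of_nonneg factor_nonneg]
  refine (mul_le_mul_of_nonneg_left (abs_meanLevel_finalState_sub_le hc) factor_nonneg).trans_eq ?_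
  field_simp

/-- The price of an item as a real number. -/
noncomputable def choicePrice (o : Fin I.n → Scheme.Choice) (i : Fin I.n) : ℝ :=
  (o i).price.1 / (o i).price.2

theorem choicePrice_plan_of_mem (hr : 0 < r) {i : Fin I.n} (hi : i ∈ T) :
    choicePrice (I.plan r E T c x) i = (1 - 1 / r) * (E / I.denom ^ 2 / (r : ℝ) ^ 2 * c i) := by
  have := I.cast_denom_pos
  have : (0 : ℝ) < r := by exact_mod_cast hr
  rw [choicePrice, plan, if_pos hi, lowOption, Scheme.lowChoice]
  push_cast [Nat.cast_sub (Nat.one_le_of_lt hr)]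
  field_simp

theorem choicePrice_plan_of_notMem (hr : 0 < r) {i : Fin I.n} (hi : i ∉ T) :
    choicePrice (I.plan r E T c x) i = (1 - 1 / r) * I.highPrice r E (x i) := by
  have := I.cast_denom_pos
  have : (0 : ℝ) < r := by exact_mod_cast hr
  rw [choicePrice, plan, if_neg hi, highOption, Scheme.highChoice, highPrice]
  push_cast [Nat.cast_sub (Nat.one_le_of_lt hr)]
  field_simp

theorem nonempty_massPoints (I : Instance) (i : Fin I.n) : Nonempty (Fin (I.K i)) := by
  by_contra empty
  rw [not_nonempty_iff] at empty
  simpa using I.prob_sum i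

theorem exists_mul_tail_le_highPrice {i : Fin I.n} {y : ℝ}
    (hy : (r : ℝ) ^ 2 * (E / I.denom ^ 2) ≤ y) : ∃ k, y * I.tail i y ≤
      I.highPrice r E (I.point i k) * I.tail i (I.highPrice r E (I.point i k)) := by
  rcases tail_eq_zero_or_exists i y with zero | ⟨k, hk, eq⟩
  · obtain ⟨k⟩ := I.nonempty_massPoints i
    refine ⟨k, ?_⟩
    rw [zero, mul_zero]
    exact mul_nonneg (div_nonneg (Nat.cast_nonneg _) (by positivity)) (I.tail_nonneg _ _)
  · have le_point : r ^ 2 * E ≤ I.point i k := by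
      rw [le_point_iff]
      push_cast
      rw [mul_div_assoc]
      exact hy.trans hk
    refine ⟨k, ?_⟩
    rw [highPrice, max_eq_left le_point, point_div, eq]
    exact mul_le_mul_of_nonneg_right hk (I.tail_nonneg _ _)

theorem exists_level {S q : ℝ} (hr : 0 < r) (hS : 0 < S) (hq : 0 ≤ q) (lt : q < (r : ℝ) ^ 2 * S) :
    ∃ c ≤ r ^ 4, S / (r : ℝ) ^ 2 * c ≤ (1 - 1 / r) * q ∧
      (1 - 1 / r) * q < S / (r : ℝ) ^ 2 * (c + 1) := by
  have : (0 : ℝ) < r := by exact_mod_cast hr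
  have hr1 : (1 : ℝ) ≤ r := by exact_mod_cast hr
  have unit_pos : 0 < S / (r : ℝ) ^ 2 := by positivity
  have floor_le := Nat.floor_le (div_nonneg (mul_nonneg (one_sub_inv_nonneg hr1) hq) unit_pos.le)
  have lt_floor := Nat.lt_floor_add_one ((1 - 1 / r) * q / (S / (r : ℝ) ^ 2))
  rw [le_div_iff₀' unit_pos] at floor_le
  rw [div_lt_iff₀' unit_pos] at lt_floor
  refine ⟨_, Nat.floor_le_of_le ?_, floor_le, lt_floor⟩
  rw [div_le_iff₀ unit_pos]
  calc (1 - 1 / r) * q ≤ q := one_sub_inv_mul_le hr1 hq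
    _ ≤ (r : ℝ) ^ 2 * S := lt.le
    _ = ((r ^ 4 : ℕ) : ℝ) * (S / (r : ℝ) ^ 2) := by
      push_cast
      field_simp

theorem exists_plan_revenue_le_estimate (hr : 2 ≤ r) (hE : 0 < E)
    (scale : I.IsScale (E / I.denom ^ 2)) {p : Fin I.n → ℝ} (hp : ∀ i, 0 ≤ p i) :
    ∃ (T : Finset (Fin I.n)) (c x : Fin I.n → ℕ), (∀ i ∈ T, c i ≤ r ^ 4) ∧
      (∀ i ∉ T, ∃ k, x i = I.point i k) ∧
      (1 - 1 / r) * I.revenue p ≤ I.estimate r E T c x + 4 * (E / I.denom ^ 2) / r := by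
  classical
  have denom_pos := I.cast_denom_pos
  have scale_pos : (0 : ℝ) < E / I.denom ^ 2 := by positivity
  let T : Finset (Fin I.n) := Finset.univ.filter fun i => p i < (r : ℝ) ^ 2 * (E / I.denom ^ 2)
  have low : ∀ i ∈ T, p i < (r : ℝ) ^ 2 * (E / I.denom ^ 2) := by simp [T]
  have high : ∀ i ∉ T, (r : ℝ) ^ 2 * (E / I.denom ^ 2) ≤ p i := by simp [T]
  choose! c hC hc using fun i hi => exists_level (by omega) scale_pos (hp i) (low i hi)
  choose k hk using fun i hi => exists_mul_tail_le_highPrice (i := i) (high i hi)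
  let x : Fin I.n → ℕ := fun i => if hi : i ∈ T then 0 else I.point i (k i hi)
  have x_eq : ∀ i hi, x i = I.point i (k i hi) := fun i hi => dif_neg hi
  refine ⟨T, c, x, hC, fun i hi => ⟨k i hi, x_eq i hi⟩, ?_⟩
  have high_le : ∑ j ∈ Tᶜ, p j * I.tail j (p j) ≤
      ∑ j ∈ Tᶜ, I.highPrice r E (x j) * I.tail j (I.highPrice r E (x j)) :=
    Finset.sum_le_sum fun j hj => by
      rw [x_eq j (Finset.mem_compl.1 hj)]
      exact hk j _
  have := revenue_le_estimate scale scale_pos hr (isLevel_levels (by omega) hE) hp low hc hC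
  rw [estimate]
  linarith

theorem estimate_le_revenue_choicePrice (hr : 2 ≤ r) (hE : 0 < E)
    (scale : I.IsScale (E / I.denom ^ 2)) (hc : ∀ i ∈ T, c i ≤ r ^ 4) :
    (1 - 1 / r) ^ 2 * I.estimate r E T c x ≤
      I.revenue (choicePrice (I.plan r E T c x)) + 2 * (E / I.denom ^ 2) / r := by
  have denom_pos := I.cast_denom_pos
  have r_pos : 0 < r := by omega
  exact estimate_le_revenue scale (by positivity) hr (isLevel_levels r_pos hE) hc
    (fun i hi => choicePrice_plan_of_mem r_pos hi) (fun i _ => le_highPrice _)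
    fun i hi => choicePrice_plan_of_notMem r_pos (Finset.mem_compl.1 hi)

theorem revenue_le_of_normalizedMerit_le (hr : 2 ≤ r) (hE : 0 < E)
    (scale : I.IsScale (E / I.denom ^ 2)) {o : Fin I.n → Scheme.Choice}
    (ho : ∀ i, o i ∈ I.options r E i)
    (best : ∀ o' : Fin I.n → Scheme.Choice, (∀ i, o' i ∈ I.options r E i) →
      I.normalizedMerit r E o' ≤ I.normalizedMerit r E o)
    {p : Fin I.n → ℝ} (hp : ∀ i, 0 ≤ p i) :
    (1 - 3 / r) * I.revenue p ≤ I.revenue (choicePrice o) + 8 * (E / I.denom ^ 2) / r := by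
  obtain ⟨T', c', x', hc', hx', revenue_le⟩ := exists_plan_revenue_le_estimate hr hE scale hp
  obtain ⟨T, c, x, hc, rfl⟩ := exists_eq_plan ho
  have merit_le := best _ (plan_mem_options hc' hx')
  have close' := abs_le.1 (abs_normalizedMerit_sub_estimate_le (E := E) (x := x') (by omega) hc')
  have close := abs_le.1 (abs_normalizedMerit_sub_estimate_le (E := E) (x := x) (by omega) hc)
  have le_revenue := estimate_le_revenue_choicePrice (x := x) hr hE scale hc
  have hr2 : (2 : ℝ) ≤ r := by exact_mod_cast hr
  set d : ℝ := 1 / r with hd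
  set B : ℝ := E / I.denom ^ 2 / r with hB
  have d_nonneg : 0 ≤ d := by positivity
  have d_le : d ≤ 1 := by
    rw [hd, div_le_one (by linarith)]
    linarith
  have B_nonneg : 0 ≤ B := by positivity
  rw [mul_div_assoc, ← hB] at revenue_le le_revenue
  have revenue_le_estimate : (1 - d) * I.revenue p ≤ I.estimate r E T c x + 6 * B := by
    linarith [close'.1, close.2]
  calc (1 - 3 / r) * I.revenue p ≤ (1 - d) ^ 2 * ((1 - d) * I.revenue p) := by
        rw [← mul_assoc, ← mul_one_div 3, ← hd]
        refine mul_le_mul_of_nonneg_right ?_ (revenue_nonneg hp)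
        nlinarith [mul_nonneg (sq_nonneg d) (by linarith : 0 ≤ 3 - d)]
    _ ≤ (1 - d) ^ 2 * I.estimate r E T c x + (1 - d) ^ 2 * (6 * B) := by
        rw [← mul_add]
        exact mul_le_mul_of_nonneg_left revenue_le_estimate (sq_nonneg _)
    _ ≤ I.revenue (choicePrice (I.plan r E T c x)) + 2 * B + 6 * B :=
        add_le_add le_revenue (mul_le_of_le_one_left (by positivity) (by nlinarith))
    _ = I.revenue (choicePrice (I.plan r E T c x)) + 8 * (E / I.denom ^ 2) / r := by
        rw [mul_div_assoc, ← hB]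
        ring

end Instance

namespace Scheme

theorem le_accuracy (e : ℕ × ℕ) : 100 ≤ accuracy e :=
  Nat.le_mul_of_pos_right 100 (Nat.succ_pos _)

theorem div_accuracy_le {e : ℕ × ℕ} (num_pos : 0 < e.1) (den_pos : 0 < e.2) :
    (35 : ℝ) / accuracy e ≤ e.1 / e.2 := by
  have accuracy_pos : 0 < accuracy e := (le_accuracy e).trans_lt' (by norm_num)
  have den_lt : e.2 < e.1 * (e.2 / e.1 + 1) := Nat.lt_mul_div_succ _ num_pos
  have : 35 * e.2 ≤ e.1 * accuracy e := by
    rw [accuracy]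
    linarith
  rw [div_le_div_iff₀ (by exact_mod_cast accuracy_pos) (by exact_mod_cast den_pos)]
  exact_mod_cast this

end Scheme

namespace Instance

variable {I : Instance} {r E : ℕ}

theorem solve_raw (I : Instance) (e : ℕ × ℕ) : Scheme.solve (e, I.raw) =
    Scheme.prices (Scheme.accuracy e) (Scheme.scale I.denom (List.ofFn I.item)) I.denom
      (Scheme.resolution (Scheme.accuracy e) I.n) (List.range (Scheme.accuracy e ^ 4 + 1))
      (List.range (Scheme.numRanks (Scheme.accuracy e)))
      (Scheme.vectors (List.range (Scheme.resolution (Scheme.accuracy e) I.n + 1))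
        (List.range (Scheme.numRanks (Scheme.accuracy e)))) (List.ofFn I.item) := by
  have length_raw : I.raw.length = I.n := by simp only [raw, List.length_ofFn]
  simp only [Scheme.solve, length_raw, integral_raw]
  rfl

theorem exists_prices_eq (I : Instance) (r E : ℕ) :
    ∃ o : Fin I.n → Scheme.Choice, (∀ i, o i ∈ I.options r E i) ∧
      Scheme.prices r E I.denom (Scheme.resolution r I.n) (List.range (r ^ 4 + 1))
        (List.range (Scheme.numRanks r))
        (Scheme.vectors (List.range (Scheme.resolution r I.n + 1))
          (List.range (Scheme.numRanks r))) (List.ofFn I.item) =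
        List.ofFn (fun i => (o i).price) ∧
      ∀ o' : Fin I.n → Scheme.Choice, (∀ i, o' i ∈ I.options r E i) →
        I.normalizedMerit r E o' ≤ I.normalizedMerit r E o := by
  have nonempty : ∃ xs, List.Forall₂ (· ∈ ·) xs (List.ofFn (I.options r E)) :=
    ⟨_, forall₂_ofFn_right.2 ⟨fun i => I.lowOption r E i 0, rfl, fun i =>
      mem_options.2 (.inl ⟨0, Nat.zero_le _, rfl⟩)⟩⟩
  have proper : ∀ opts ∈ List.ofFn (I.options r E), ∀ o ∈ opts,
      Scheme.IsProper I.denom (List.range (Scheme.numRanks r)) o := by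
    rw [List.forall_mem_ofFn_iff]
    exact fun i o ho => isProper_of_mem_options ho
  obtain ⟨_, mem, argmax_eq, le⟩ := Scheme.exists_path_eq_argmax_states (r := r) (E := E)
    (M := Scheme.resolution r I.n) (Z := Scheme.vectors
      (List.range (Scheme.resolution r I.n + 1)) (List.range (Scheme.numRanks r)))
    (fun z => by simp only [Scheme.mem_vectors, List.mem_range, Nat.lt_succ_iff])
    proper nonempty
  obtain ⟨o, rfl, ho⟩ := forall₂_ofFn_right.1 mem
  refine ⟨o, ho, ?_, fun o' ho' => ?_⟩
  · rw [Scheme.prices, List.map_ofFn]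
    change Option.elim (List.argmax _ (Scheme.states _ _ _ _ (List.ofFn (I.options r E)))) _ _ = _
    rw [argmax_eq, Option.elim_some, Scheme.path_prices, List.map_ofFn]
    rfl
  · exact div_le_div_of_nonneg_right
      (by exact_mod_cast le _ (forall₂_ofFn_right.2 ⟨o', rfl, ho'⟩)) (by positivity)

theorem IsScale.revenue_le_of_forall_le {S R δ : ℝ} (scale : I.IsScale S) (hδ : 35 ≤ δ)
    (le : ∀ p : Fin I.n → ℝ, (∀ i, 0 ≤ p i) → (1 - 3 / δ) * I.revenue p ≤ R + 8 * S / δ)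
    {p : Fin I.n → ℝ} (hp : ∀ i, 0 ≤ p i) : (1 - 35 / δ) * I.revenue p ≤ R := by
  have δ_pos : 0 < δ := by linarith
  obtain ⟨p₀, hp₀, scale_le⟩ := scale.le_revenue
  obtain ⟨p₁, hp₁, p_le, p₀_le⟩ : ∃ p₁ : Fin I.n → ℝ, (∀ i, 0 ≤ p₁ i) ∧
      I.revenue p ≤ I.revenue p₁ ∧ I.revenue p₀ ≤ I.revenue p₁ := by
    rcases le_total (I.revenue p) (I.revenue p₀) with h | h
    · exact ⟨p₀, hp₀, h, le_rfl⟩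
    · exact ⟨p, hp, le_rfl, h⟩
  have error_le : 8 * S / δ ≤ 32 / δ * I.revenue p₁ := by
    rw [div_mul_eq_mul_div]
    exact div_le_div_of_nonneg_right (by linarith) δ_pos.le
  calc (1 - 35 / δ) * I.revenue p ≤ (1 - 35 / δ) * I.revenue p₁ :=
        mul_le_mul_of_nonneg_left p_le (sub_nonneg.2 ((div_le_one δ_pos).2 hδ))
    _ = (1 - 3 / δ) * I.revenue p₁ - 32 / δ * I.revenue p₁ := by ring
    _ ≤ R := by linarith [le p₁ hp₁]

theorem choicePrice_nonneg (o : Fin I.n → Scheme.Choice) (i : Fin I.n) : 0 ≤ choicePrice o i :=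
  div_nonneg (Nat.cast_nonneg _) (Nat.cast_nonneg _)

theorem exists_solve_eq (I : Instance) {e : ℕ × ℕ} (num_pos : 0 < e.1) (den_pos : 0 < e.2) :
    ∃ o : Fin I.n → Scheme.Choice, Scheme.solve (e, I.raw) = List.ofFn (fun i => (o i).price) ∧
      (∀ i, 0 < (o i).price.2) ∧ ∀ p : Fin I.n → ℝ, (∀ i, 0 ≤ p i) →
        (1 - (e.1 : ℝ) / e.2) * I.revenue p ≤ I.revenue (choicePrice o) := by
  rw [solve_raw]
  have scale := I.isScale_scale
  have accuracy_le := Scheme.div_accuracy_le num_pos den_pos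
  have le_accuracy := Scheme.le_accuracy e
  generalize Scheme.scale I.denom (List.ofFn I.item) = E at *
  generalize Scheme.accuracy e = r at *
  obtain ⟨o, ho, prices_eq, best⟩ := I.exists_prices_eq r E
  refine ⟨o, prices_eq, fun i => price_snd_pos_of_mem_options (by omega) (ho i), fun p hp => ?_⟩
  rcases Nat.eq_zero_or_pos E with rfl | hE
  · have revenue_le := scale.revenue_le p hp
    rw [Nat.cast_zero, zero_div] at revenue_le
    rw [le_antisymm revenue_le (revenue_nonneg hp), mul_zero]
    exact revenue_nonneg (choicePrice_nonneg o)
  · have hr : (35 : ℝ) ≤ r := by exact_mod_cast le_accuracy.trans' (by norm_num)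
    calc (1 - (e.1 : ℝ) / e.2) * I.revenue p ≤ (1 - 35 / r) * I.revenue p :=
          mul_le_mul_of_nonneg_right (sub_le_sub_left accuracy_le 1) (revenue_nonneg hp)
      _ ≤ I.revenue (choicePrice o) := scale.revenue_le_of_forall_le hr
          (fun p hp => revenue_le_of_normalizedMerit_le (by omega) hE scale ho best hp) hp

end Instance

theorem encodePrices_eq {n : ℕ} (x : Fin n → ℕ × ℕ) :
    encodePrices (fun i => (x i).1) (fun i => (x i).2) = BitCost.Enc.enc (List.ofFn x) := by
  simp only [encodePrices, BitCost.Enc.enc, List.map_ofFn, Function.comp_def]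
  rfl

end UnitDemand

/-- There is a multiplicative PTAS for unit-demand pricing with independent, finitely supported
values and unrestricted prices: one program `A` that, on input `(ε, I)`, outputs rational prices whose
expected revenue is at least `1 - ε` times that of all nonnegative real prices, in time polynomial in
the bit size of the instance `I` for every fixed `ε`. -/
theorem mainTheorem7 :
    ∃ A : BitCost.Prog, ∀ ε : NNRat, 0 < ε → ε < 1 →
      ∃ q : Polynomial ℕ, ∀ I : UnitDemand.Instance,
        ∃ (a b : Fin I.n → ℕ) (t : ℕ),
          (∀ i, 0 < b i) ∧
          BitCost.Runs A (.pair (.rat ε) I.encode) (UnitDemand.encodePrices a b) t ∧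
          t ≤ q.eval I.encode.size ∧
          ∀ p : Fin I.n → ℝ, (∀ i, 0 ≤ p i) →
            (1 - (ε : ℝ)) * I.revenue p ≤ I.revenue (fun i => (a i : ℝ) / (b i : ℝ)) := by
  obtain ⟨A, q, run⟩ := UnitDemand.Scheme.timeIn_solve
  refine ⟨A, fun ε hε _ => ?_⟩
  obtain ⟨costBound, cost_le⟩ := UnitDemand.Scheme.exists_polynomial_cost_le (ε.num, ε.den)
  refine ⟨q.comp costBound, fun I => ?_⟩
  obtain ⟨o, solve_eq, den_pos, revenue_le⟩ := I.exists_solve_eq (e := (ε.num, ε.den))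
    (NNRat.num_pos.2 hε) ε.den_pos
  obtain ⟨t, solve_run, time_le⟩ := run ((ε.num, ε.den), I.raw)
  refine ⟨fun i => (o i).price.1, fun i => (o i).price.2, t, den_pos, ?_, ?_, fun p hp => ?_⟩
  · rw [I.encode_eq, UnitDemand.encodePrices_eq fun i => (o i).price, ← solve_eq]
    exact solve_run
  · rw [Polynomial.eval_comp, I.encode_eq]
    exact time_le.trans (BitCost.monotone_polynomial_eval q (cost_le I.raw))
  · rw [NNRat.cast_def]
    exact revenue_le p hp
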